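/- Let $L\subseteq\mathbb R^d$ be uniformly discrete, i.e. there is $\varepsilon>0$ with $|x-y|>\varepsilon$ for all distinct $x,y\in L$. Let $\hat{\mathbb 1}_L$ be the Fourier transform (with $\hat f(\xi)=\int f(x)e^{-2\pi i x\cdot\xi}\,dx$) of the tempered distribution $\mathbb 1_L=\sum_{z\in L}\delta_z$, and let $L^*=\operatorname{singsupp}\hat{\mathbb 1}_L$. For $\operatorname{Re}\nu>d$ and $y\in\mathbb R^d$ put $$Z_{L,\nu}(y)=\sum_{z\in L\setminus\{0\}}\frac{e^{-2\pi i y\cdot z}}{|z|^{\nu}},$$ and let $G_\nu(z)=\Gamma(\nu/2,\pi|z|^2)\,(\pi|z|^2)^{-\nu/2}$ for $z\ne0$, $G_\nu(0)=-2/\nu$, where $\Gamma(s,x)$ is the upper incomplete Gamma function. For every $y\in\mathbb R^d\setminus L^*$ the above series converges absolutely for $\operatorname{Re}\nu>d$, and $\nu\mapsto Z_{L,\nu}(y)$ extends to a meromorphic function on $\mathbb C$, which has no poles. For every $\lambda>0$, every $y\in\mathbb R^d\setminus L^*$ and every $\nu\in\mathbb C\setminus\{0,-2,-4,\dots\}$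 the extension is given by $$Z_{L,\nu}(y)=\frac{\pi^{\nu/2}}{\lambda^{\nu}\,\Gamma(\nu/2)}\Bigl(\sum_{z\in L}e^{-2\pi i y\cdot z}\,G_\nu(z/\lambda)+\lambda^d\bigl(\hat{\mathbb 1}_L*G_{d-\nu}(\lambda\,\cdot)\bigr)(y)\Bigr),$$ with an absolutely convergent sum, which includes the term $z=0$ if $0\in L$. Here $G_{d-\nu}(\lambda\,\cdot)$ is a locally integrable function acting as a tempered distribution by integration if $\operatorname{Re}\nu>0$, and its meromorphic continuation in $\nu$, as a tempered distribution with poles at most at $0,-2,-4,\dots$, otherwise. The convolution at $y\notin L^*$ is $(u*v)(y)=u\bigl(((1-\chi)v)(y-\cdot)\bigr)+v\bigl(\chi\, f(y-\cdot)\bigr)$, where $u=\hat{\mathbb 1}_L$, $v=G_{d-\nu}(\lambda\,\cdot)$, $\chi$ is a compactly supported smooth function such that $u$ is a smooth function $f$ on an open set containing $y-\operatorname{supp}\chi$ and such that $(1-\chi)v$ is a Schwartz function (the value does not depend on $\chi$). Moreover, for every fixed $\nu\in\mathbb C$, the function $y\mapsto Z_{L,\nu}(y)$ so extended is smooth on $\mathbb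 R^d\setminus L^*$. -/

import Mathlib

open MeasureTheory
open scoped SchwartzMap FourierTransform ContDiff

noncomputable section

/-- A subset of `ℝ^d` is uniformly discrete if its distinct points are uniformly separated. -/
def UniformlyDiscrete {d : ℕ} (L : Set (EuclideanSpace ℝ (Fin d))) : Prop :=
  ∃ ε : ℝ, 0 < ε ∧ ∀ x ∈ L, ∀ y ∈ L, x ≠ y → ε < dist x y

/-- The term `e^{-2πi y·z} / |z|^ν` of the set zeta function. -/
def setZetaTerm {d : ℕ} (ν : ℂ) (y z : EuclideanSpace ℝ (Fin d)) : ℂ :=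
  Complex.exp (-2 * Real.pi * Complex.I * (inner ℝ y z : ℝ)) / ((‖z‖ : ℝ) : ℂ) ^ ν

/-- The set zeta function as a Dirichlet series (used only for `Re ν > d`); the origin is left
out of the sum. -/
def setZeta {d : ℕ} (L : Set (EuclideanSpace ℝ (Fin d))) (ν : ℂ)
    (y : EuclideanSpace ℝ (Fin d)) : ℂ :=
  ∑' z : ↥(L \ {0}), setZetaTerm ν y (z : EuclideanSpace ℝ (Fin d))

/-- The upper incomplete Gamma function `Γ(s, x) = ∫_x^∞ t^{s-1} e^{-t} dt`, for `x > 0`. -/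
def upperGamma (s : ℂ) (x : ℝ) : ℂ :=
  ∫ t in Set.Ioi x, (t : ℂ) ^ (s - 1) * (Real.exp (-t) : ℂ)

/-- `G_ν(z) = Γ(ν/2, π z²) / (π z²)^{ν/2}` for `z ≠ 0`, and `G_ν(0) = -2/ν`. -/
def crandallG {d : ℕ} (ν : ℂ) (z : EuclideanSpace ℝ (Fin d)) : ℂ :=
  open Classical in
  if z = 0 then -2 / ν
  else upperGamma (ν / 2) (Real.pi * ‖z‖ ^ 2) / ((Real.pi * ‖z‖ ^ 2 : ℝ) : ℂ) ^ (ν / 2)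

/-- The generalized Dirac comb `∑_{z ∈ L} δ_z`; the series is taken in the space of tempered
distributions with the topology of pointwise convergence, where it converges for every
uniformly discrete `L`. -/
def diracComb {d : ℕ} (L : Set (EuclideanSpace ℝ (Fin d))) : 𝓢'(EuclideanSpace ℝ (Fin d), ℂ) :=
  ∑' z : L, TemperedDistribution.delta (z : EuclideanSpace ℝ (Fin d))

/-- The form factor: the Fourier transform of the Dirac comb. -/
def formFactor {d : ℕ} (L : Set (EuclideanSpace ℝ (Fin d))) : 𝓢'(EuclideanSpace ℝ (Fin d), ℂ) :=
  𝓕 (diracComb L)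

/-- The restriction of `u` to the open set `V` is the smooth function `f`. -/
def IsSmoothFunctionOn {d : ℕ} (u : 𝓢'(EuclideanSpace ℝ (Fin d), ℂ))
    (f : EuclideanSpace ℝ (Fin d) → ℂ) (V : Set (EuclideanSpace ℝ (Fin d))) : Prop :=
  IsOpen V ∧ ContDiffOn ℝ ∞ f V ∧
    ∀ φ : 𝓢(EuclideanSpace ℝ (Fin d), ℂ), HasCompactSupport φ → tsupport φ ⊆ V →
      u φ = ∫ x, f x * φ x

/-- The singular support of a tempered distribution. -/
def singSupp {d : ℕ} (u : 𝓢'(EuclideanSpace ℝ (Fin d), ℂ)) : Set (EuclideanSpace ℝ (Fin d)) :=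
  {x | ¬ ∃ V f, x ∈ V ∧ IsSmoothFunctionOn u f V}

/-- The convolution `u ∗ v` of two tempered distributions has the value `c` at the point `y`.
Here `v` is cut into `χ v`, with `χ` a compactly supported smooth function such that `u` is a
smooth function `f` near `y - supp χ`, and `(1 - χ) v`, which has to be a Schwartz function `ψ`;
then `c = u(ψ(y - ·)) + v(χ f(y - ·))`. The value does not depend on the choices, and if `v` is
a Schwartz function it is the usual `u(v(y - ·))` (take `χ = 0`). -/
def HasConvolutionAt {d : ℕ} (u v : 𝓢'(EuclideanSpace ℝ (Fin d), ℂ))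
    (y : EuclideanSpace ℝ (Fin d)) (c : ℂ) : Prop :=
  ∃ (χ f : EuclideanSpace ℝ (Fin d) → ℂ) (V : Set (EuclideanSpace ℝ (Fin d)))
    (ψ ψy F : 𝓢(EuclideanSpace ℝ (Fin d), ℂ)),
    ContDiff ℝ ∞ χ ∧ HasCompactSupport χ ∧
    IsSmoothFunctionOn u f V ∧ (∀ x ∈ tsupport χ, y - x ∈ V) ∧
    (∀ φ φ' : 𝓢(EuclideanSpace ℝ (Fin d), ℂ), (∀ x, φ' x = (1 - χ x) * φ x) →
      v φ' = ∫ x, ψ x * φ x) ∧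
    (∀ z, ψy z = ψ (y - z)) ∧
    (∀ x, F x = χ x * f (y - x)) ∧
    c = u ψy + v F

/-- `T ν` is the kernel `x ↦ G_{d-ν}(lam x)` as a tempered distribution: for `Re ν > 0` this
function is locally integrable and acts by integration, and for the other `ν` outside
`{0, -2, -4, …}` the distribution is obtained by meromorphic continuation in `ν`. -/
def IsKernelDistribution {d : ℕ} (lam : ℝ) (T : ℂ → 𝓢'(EuclideanSpace ℝ (Fin d), ℂ)) : Prop :=
  ∀ φ : 𝓢(EuclideanSpace ℝ (Fin d), ℂ),
    Meromorphic (fun ν => T ν φ) ∧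
    (∀ ν : ℂ, (∀ n : ℕ, ν ≠ -2 * (n : ℂ)) → AnalyticAt ℂ (fun ν => T ν φ) ν) ∧
    ∀ ν : ℂ, 0 < ν.re →
      Integrable (fun x => crandallG ((d : ℂ) - ν) (lam • x) * φ x) ∧
      T ν φ = ∫ x, crandallG ((d : ℂ) - ν) (lam • x) * φ x

end

/-! Put `s = ν/2` and `x = π|z|²/λ²`. The Mellin integral `Γ(s) x^{-s} = ∫₀^∞ t^{s-1} e^{-xt} dt`,
cut at `t = 1` and divided by `Γ(s)`, writes `x^{-s}` as `regUpper s x + regLower s x`, both entire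
in `s`. At `x = 0` the two values cancel, which accounts for both `G_ν(0) = -2/ν` and the missing
term at the origin. Away from the origin the upper terms have Gaussian decay, so their sum over `L`
is entire in `ν` and smooth in `y`.

The lower terms need not be summable, but by `fourier_crandallG_smul` they are, up to the factors
`Γ(ν/2)` and `λ^d`, the Fourier transform of the kernel `G_{d-ν}(λ·)` when `Re ν > 0`. Their sum is
thus formally the form factor paired with the reflected kernel. A cutoff `χ` gives this a meaning.
The part of the kernel away from the origin is a Schwartz function (`exists_schwartz_kernel`), to
which the form factor applies termwise. Near the origin the form factor is a smooth function `f`,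
and the kernel is paired with the test function `χ f(y - ·)`. Moved to the Fourier side, this
pairing becomes `kernelReg`, which is entire in `ν` because `regLower` grows polynomially, locally
uniformly in `s` (`exists_norm_regLower_le`).

For `Re ν > d` the kernel is continuous and the lower series converges absolutely, being the zeta
series minus the upper one. The mollification argument `tsum_fourier_eq_integral` then turns the
formal pairing into an identity. So each local formula continues the Dirichlet series, and the
identity theorem makes the formulas for different `λ` and different base points agree. Smoothness in
`y` follows since the pieces are Fourier series or Fourier transforms with rapidly decaying
coefficients, and convolutions of Schwartz functions. -/

open Filter Topology Set

/-! ### Holomorphic parameter integrals. -/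

section HolomorphicIntegral

/-- An integral depending on a complex parameter is holomorphic if the integrand is holomorphic
and locally dominated by an integrable function; no bound on the derivative is needed. -/
theorem differentiableAt_integral_of_dominated {α : Type*} [MeasurableSpace α] {μ : Measure α}
    {F : ℂ → α → ℂ} {U : Set ℂ} {s₀ : ℂ} (hU : U ∈ 𝓝 s₀) {bound : α → ℝ}
    (hmeas : ∀ s ∈ U, AEStronglyMeasurable (F s) μ)
    (hb : ∀ᵐ a ∂μ, ∀ s ∈ U, ‖F s a‖ ≤ bound a) (hbi : Integrable bound μ)
    (hd : ∀ᵐ a ∂μ, DifferentiableOn ℂ (fun s => F s a) U) :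
    DifferentiableAt ℂ (fun s => ∫ a, F s a ∂μ) s₀ := by
  obtain ⟨R, hR, hRU⟩ := Metric.mem_nhds_iff.1 hU
  -- With a third of the radius, circles of radius `r` about points of the `r`-ball stay where the
  -- bound holds, so Cauchy's estimate bounds the derivative by `bound / r`.
  set r : ℝ := R / 3 with hr
  have hr0 : 0 < r := by positivity
  have hsub : ∀ x ∈ Metric.ball s₀ r, Metric.closedBall x r ⊆ Metric.ball s₀ R := by
    intro x hx y hy
    rw [Metric.mem_ball] at hx ⊢
    rw [Metric.mem_closedBall] at hy
    linarith [dist_triangle y x s₀]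
  have hballU : Metric.ball s₀ r ⊆ U :=
    (Metric.ball_subset_ball (by linarith)).trans hRU
  have hdiff : ∀ᵐ a ∂μ, ∀ x ∈ Metric.ball s₀ r,
      HasDerivAt (fun s => F s a) (deriv (fun s => F s a) x) x := by
    filter_upwards [hd] with a ha x hx
    refine (ha.differentiableAt ?_).hasDerivAt
    exact mem_of_superset (Metric.isOpen_ball.mem_nhds hx) hballU
  have hs₀ : s₀ ∈ Metric.ball s₀ r := Metric.mem_ball_self hr0
  refine (hasDerivAt_integral_of_dominated_loc_of_deriv_le (μ := μ) (𝕜 := ℂ) (F := F)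
    (F' := fun s a => deriv (fun s => F s a) s) (bound := fun a => bound a / r)
    (Metric.ball_mem_nhds s₀ hr0) ?_ ?_ ?_ ?_ (hbi.div_const r) hdiff).2.differentiableAt
  · filter_upwards [hU] with s hs using hmeas s hs
  · refine hbi.mono' (hmeas s₀ (hballU hs₀)) ?_
    filter_upwards [hb] with a ha using ha s₀ (hballU hs₀)
  -- The derivative at `s₀` is measurable as a limit of difference quotients along a sequence.
  · let c : ℕ → ℂ := fun n => s₀ + ((r / 2 / (n + 1) : ℝ) : ℂ)
    have hc : ∀ n, c n ∈ U := by
      intro n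
      apply hballU
      simp only [c, Metric.mem_ball, dist_self_add_left, Complex.norm_real, Real.norm_eq_abs]
      rw [abs_of_pos (by positivity), div_lt_iff₀ (by positivity)]
      nlinarith [(Nat.cast_nonneg n : (0 : ℝ) ≤ n)]
    have hct : Tendsto c atTop (𝓝[≠] s₀) := by
      refine tendsto_nhdsWithin_iff.2 ⟨?_, Eventually.of_forall fun n => ?_⟩
      · have h1 : Tendsto (fun n : ℕ => r / 2 / ((n : ℝ) + 1)) atTop (𝓝 0) :=
          tendsto_const_nhds.div_atTop
            (tendsto_atTop_add_const_right _ _ tendsto_natCast_atTop_atTop)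
        have h2 := (Complex.continuous_ofReal.tendsto 0).comp h1
        have h3 := h2.const_add s₀
        simpa [c, Function.comp_def] using h3
      · have h4 : (r / 2 / ((n : ℝ) + 1)) ≠ 0 := by positivity
        simp only [c, mem_compl_iff, mem_singleton_iff, add_eq_left]
        exact_mod_cast h4
    refine aestronglyMeasurable_of_tendsto_ae atTop
      (f := fun n a => slope (fun s => F s a) s₀ (c n)) (fun n => ?_) ?_
    · simp only [slope_def_module]
      exact ((hmeas _ (hc n)).sub (hmeas _ (hballU hs₀))).const_smul (c n - s₀)⁻¹
    · filter_upwards [hdiff] with a ha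
      exact (ha s₀ hs₀).tendsto_slope.comp hct
  · filter_upwards [hb, hd] with a ha hda x hx
    refine Complex.norm_deriv_le_of_forall_mem_sphere_norm_le hr0 ?_ fun z hz => ?_
    · refine (hda.mono ((hsub x hx).trans hRU)).diffContOnCl_ball ?_
      exact Subset.rfl
    · exact ha z (hRU (hsub x hx (Metric.sphere_subset_closedBall hz)))

end HolomorphicIntegral

/-! ### Lattice-type sums over uniformly discrete sets. -/

section UniformlyDiscrete

variable {d : ℕ} {L : Set (EuclideanSpace ℝ (Fin d))}

/-- A packing argument: the balls of radius `ε/2` about the points are disjoint, and on each of them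
`1 + ‖x‖ ≤ (1 + ‖z‖)(1 + ε/2)`. Every partial sum is therefore bounded by a multiple of one
convergent integral. -/
theorem UniformlyDiscrete.summable_one_add_norm_rpow (hL : UniformlyDiscrete L) {r : ℝ}
    (hr : (d : ℝ) < r) :
    Summable (fun z : L => (1 + ‖(z : EuclideanSpace ℝ (Fin d))‖) ^ (-r)) := by
  obtain ⟨ε, hε, hsep⟩ := hL
  have hr0 : 0 < r := lt_of_le_of_lt (Nat.cast_nonneg d) hr
  have hint : Integrable (fun x : EuclideanSpace ℝ (Fin d) => (1 + ‖x‖) ^ (-r)) :=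
    integrable_one_add_norm (by simpa using hr)
  set v : ℝ := (volume (Metric.ball (0 : EuclideanSpace ℝ (Fin d)) (ε / 2))).toReal with hv
  have hv0 : 0 < v := ENNReal.toReal_pos (Metric.measure_ball_pos _ _ (by positivity)).ne'
    measure_ball_lt_top.ne
  have key : ∀ z : EuclideanSpace ℝ (Fin d), (1 + ‖z‖) ^ (-r) * ((1 + ε / 2) ^ (-r) * v) ≤
      ∫ x in Metric.ball z (ε / 2), (1 + ‖x‖) ^ (-r) := by
    intro z
    have : ∫ x in Metric.ball z (ε / 2), (1 + ‖z‖) ^ (-r) * (1 + ε / 2) ^ (-r) ≤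
        ∫ x in Metric.ball z (ε / 2), (1 + ‖x‖) ^ (-r) := by
      refine setIntegral_mono_on (integrableOn_const measure_ball_lt_top.ne)
        hint.integrableOn measurableSet_ball fun x hx => ?_
      rw [← Real.mul_rpow (by positivity) (by positivity)]
      refine Real.rpow_le_rpow_of_nonpos (by positivity) ?_ (by linarith)
      have h1 : ‖x‖ ≤ ‖z‖ + ε / 2 := by
        rw [mem_ball_iff_norm] at hx
        linarith [norm_le_norm_add_norm_sub' x z]
      nlinarith [norm_nonneg z]
    refine le_trans (le_of_eq ?_) this
    rw [setIntegral_const, smul_eq_mul, measureReal_def, Measure.addHaar_ball_center]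
    ring
  set c : ℝ := (1 + ε / 2) ^ (-r) * v with hc
  have hc0 : 0 < c := by positivity
  refine summable_of_sum_le (c := c⁻¹ * ∫ x : EuclideanSpace ℝ (Fin d), (1 + ‖x‖) ^ (-r))
    (fun z => by positivity) fun s => ?_
  rw [le_inv_mul_iff₀ hc0, Finset.mul_sum]
  calc ∑ z ∈ s, c * (1 + ‖(z : EuclideanSpace ℝ (Fin d))‖) ^ (-r)
      ≤ ∑ z ∈ s, ∫ x in Metric.ball (z : EuclideanSpace ℝ (Fin d)) (ε / 2), (1 + ‖x‖) ^ (-r) :=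
        Finset.sum_le_sum fun z _ => by rw [mul_comm]; exact key z
    _ = ∫ x in ⋃ z ∈ s, Metric.ball (z : EuclideanSpace ℝ (Fin d)) (ε / 2),
          (1 + ‖x‖) ^ (-r) := by
        refine (integral_biUnion_finset s (fun _ _ => measurableSet_ball) ?_
          (fun _ _ => hint.integrableOn)).symm
        intro a _ b _ hab
        refine Metric.ball_disjoint_ball ?_
        have := hsep a a.2 b b.2 (fun h => hab (Subtype.ext h))
        linarith
    _ ≤ _ := setIntegral_le_integral hint (Eventually.of_forall fun x => by positivity)

/-- At most one nonzero point lies within `ε/2` of the origin; either its norm or `ε/2` serves as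
`δ`. -/
theorem UniformlyDiscrete.exists_norm_ge (hL : UniformlyDiscrete L) :
    ∃ δ : ℝ, 0 < δ ∧ ∀ z ∈ L, z ≠ 0 → δ ≤ ‖z‖ := by
  obtain ⟨ε, hε, hsep⟩ := hL
  by_cases h : ∃ z₀ ∈ L, z₀ ≠ 0 ∧ ‖z₀‖ < ε / 2
  · obtain ⟨z₀, hz₀, hz₀0, hlt⟩ := h
    refine ⟨‖z₀‖, norm_pos_iff.2 hz₀0, fun z hz _ => ?_⟩
    by_contra! hc
    have hne : z ≠ z₀ := fun h => by rw [h] at hc; exact lt_irrefl _ hc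
    have := hsep z hz z₀ hz₀ hne
    linarith [dist_eq_norm z z₀, norm_sub_le z z₀]
  · push Not at h
    exact ⟨ε / 2, by positivity, fun z hz hz0 => h z hz hz0⟩

end UniformlyDiscrete

/-! ### Characters, the Dirac comb and the form factor. -/

section Comb

variable {d : ℕ} {L : Set (EuclideanSpace ℝ (Fin d))}

/-- The character `e^{-2πi y·z}`. -/
noncomputable def phase (y z : EuclideanSpace ℝ (Fin d)) : ℂ :=
  Complex.exp (-2 * Real.pi * Complex.I * (inner ℝ y z : ℝ))

theorem phase_eq (y z : EuclideanSpace ℝ (Fin d)) :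
    phase y z = Complex.exp (((-2 * Real.pi * inner ℝ y z : ℝ) : ℂ) * Complex.I) := by
  unfold phase
  congr 1
  push_cast
  ring

@[simp]
theorem norm_phase (y z : EuclideanSpace ℝ (Fin d)) : ‖phase y z‖ = 1 := by
  rw [phase_eq, Complex.norm_exp_ofReal_mul_I]

theorem fourier_eq_integral_phase (f : EuclideanSpace ℝ (Fin d) → ℂ)
    (w : EuclideanSpace ℝ (Fin d)) : 𝓕 f w = ∫ x, phase w x * f x := by
  rw [Real.fourier_eq']
  refine integral_congr_ae (Eventually.of_forall fun x => ?_)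
  simp only [smul_eq_mul]
  rw [phase_eq, real_inner_comm]

theorem phase_add_left (x y z : EuclideanSpace ℝ (Fin d)) :
    phase (x + y) z = phase x z * phase y z := by
  simp only [phase, inner_add_left, ← Complex.exp_add]
  congr 1
  push_cast
  ring

theorem phase_comm (y z : EuclideanSpace ℝ (Fin d)) : phase y z = phase z y := by
  rw [phase, phase, real_inner_comm]

theorem phase_neg_left (y z : EuclideanSpace ℝ (Fin d)) : phase (-y) z = phase y (-z) := by
  simp only [phase, inner_neg_left, inner_neg_right]

theorem phase_sub_right (x y z : EuclideanSpace ℝ (Fin d)) :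
    phase x (y - z) = phase x y * phase (-x) z := by
  rw [sub_eq_add_neg, phase_comm, phase_add_left, phase_comm y, ← phase_comm x, phase_neg_left]

theorem fourier_comp_const_sub (f : EuclideanSpace ℝ (Fin d) → ℂ)
    (y z : EuclideanSpace ℝ (Fin d)) :
    𝓕 (fun x => f (y - x)) z = phase y z * 𝓕 f (-z) := by
  rw [fourier_eq_integral_phase, fourier_eq_integral_phase, ← integral_const_mul,
    ← integral_sub_left_eq_self _ volume y]
  refine integral_congr_ae (Eventually.of_forall fun x => ?_)
  simp only [sub_sub_cancel]
  rw [phase_sub_right, phase_comm z y]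
  ring

theorem continuous_phase_right (y : EuclideanSpace ℝ (Fin d)) : Continuous (phase y) := by
  unfold phase
  fun_prop

theorem UniformlyDiscrete.summable_one_add_norm_pow (hL : UniformlyDiscrete L) :
    Summable (fun z : L => ((1 + ‖(z : EuclideanSpace ℝ (Fin d))‖) ^ (d + 1))⁻¹) := by
  have := hL.summable_one_add_norm_rpow (r := (d + 1 : ℕ)) (by push_cast; linarith)
  refine this.congr fun z => ?_
  rw [Real.rpow_neg (by positivity), Real.rpow_natCast]

/-- Sums over a uniformly discrete set of terms of rapid decay converge. -/
theorem UniformlyDiscrete.summable_of_le (hL : UniformlyDiscrete L) {c : L → ℂ} {C : ℝ}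
    (hc : ∀ z : L, (1 + ‖(z : EuclideanSpace ℝ (Fin d))‖) ^ (d + 1) * ‖c z‖ ≤ C) :
    Summable c := by
  refine Summable.of_norm_bounded (hL.summable_one_add_norm_pow.mul_left C) fun z => ?_
  rw [← div_eq_mul_inv, le_div_iff₀ (by positivity), mul_comm]
  exact hc z

theorem SchwartzMap.one_add_norm_pow_mul_le (k : ℕ)
    (φ : 𝓢(EuclideanSpace ℝ (Fin d), ℂ)) (z : EuclideanSpace ℝ (Fin d)) :
    (1 + ‖z‖) ^ k * ‖φ z‖ ≤ 2 ^ k *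
      ((Finset.Iic (k, 0)).sup
        (schwartzSeminormFamily ℂ (EuclideanSpace ℝ (Fin d)) ℂ)) φ := by
  have := SchwartzMap.one_add_le_sup_seminorm_apply (𝕜 := ℂ) (m := (k, 0)) le_rfl le_rfl φ z
  rw [norm_iteratedFDeriv_zero] at this
  exact this

theorem UniformlyDiscrete.summable_schwartz (hL : UniformlyDiscrete L)
    (φ : 𝓢(EuclideanSpace ℝ (Fin d), ℂ)) : Summable (fun z : L => φ z) :=
  hL.summable_of_le fun z => φ.one_add_norm_pow_mul_le (d + 1) z

/-- The `tsum` of distributions has to be shown to converge. The candidate limit `A` is continuous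
by a seminorm bound, and pointwise convergence to it is just summability of each `φ` over `L`. -/
theorem UniformlyDiscrete.diracComb_apply (hL : UniformlyDiscrete L)
    (φ : 𝓢(EuclideanSpace ℝ (Fin d), ℂ)) : diracComb L φ = ∑' z : L, φ z := by
  let A : 𝓢(EuclideanSpace ℝ (Fin d), ℂ) →L[ℂ] ℂ :=
    SchwartzMap.mkCLMtoNormedSpace (σ := RingHom.id ℂ) (fun φ => ∑' z : L, φ z)
      (fun f g => (hL.summable_schwartz f).tsum_add (hL.summable_schwartz g))
      (fun a f => (hL.summable_schwartz f).tsum_const_smul a)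
      ⟨Finset.Iic (d + 1, 0),
        2 ^ (d + 1) * ∑' z : L, ((1 + ‖(z : EuclideanSpace ℝ (Fin d))‖) ^ (d + 1))⁻¹,
        mul_nonneg (by positivity) (tsum_nonneg fun z => by positivity), fun f => by
          have hs := hL.summable_one_add_norm_pow
          set S := ((Finset.Iic (d + 1, 0)).sup
            (schwartzSeminormFamily ℂ (EuclideanSpace ℝ (Fin d)) ℂ)) f
          have h1 := tsum_of_norm_bounded (f := fun z : L => f z)
            (hs.mul_left (2 ^ (d + 1) * S)).hasSum fun z => by
              rw [← div_eq_mul_inv, le_div_iff₀ (by positivity), mul_comm]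
              exact f.one_add_norm_pow_mul_le (d + 1) z
          refine h1.trans (le_of_eq ?_)
          rw [tsum_mul_left]
          ring⟩
  have hA : HasSum (fun z : L => TemperedDistribution.delta (z : EuclideanSpace ℝ (Fin d)))
      (ContinuousLinearMap.toPointwiseConvergenceCLM ℂ (RingHom.id ℂ) _ ℂ A) := by
    refine PointwiseConvergenceCLM.tendsto_iff_forall_tendsto.2 fun φ => ?_
    have h := (hL.summable_schwartz φ).hasSum
    refine h.congr fun s => ?_
    simp
  rw [diracComb, hA.tsum_eq]
  rfl

theorem UniformlyDiscrete.formFactor_apply (hL : UniformlyDiscrete L)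
    (φ : 𝓢(EuclideanSpace ℝ (Fin d), ℂ)) :
    formFactor L φ = ∑' z : L, 𝓕 (φ : EuclideanSpace ℝ (Fin d) → ℂ) z := by
  rw [formFactor, TemperedDistribution.fourier_apply, hL.diracComb_apply]
  rfl

/-- The phase is a one-variable exponential composed with the functional `⟨z, ·⟩`, whose norm is
`‖z‖`. -/
theorem norm_iteratedFDeriv_phase_le (z y : EuclideanSpace ℝ (Fin d)) (n : ℕ) :
    ‖iteratedFDeriv ℝ n (fun y => phase y z) y‖ ≤ (2 * Real.pi * ‖z‖) ^ n := by
  let h : ℝ → ℂ := fun r => Complex.exp (((-2 * Real.pi : ℝ) * Complex.I) * (r : ℂ))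
  let ℓ : EuclideanSpace ℝ (Fin d) →L[ℝ] ℝ := innerSL ℝ z
  have hh : ContDiff ℝ n h := (contDiff_const.mul Complex.ofRealCLM.contDiff).cexp
  have heq : (fun y => phase y z) = h ∘ ℓ := by
    funext y
    simp only [h, ℓ, phase_eq, Function.comp, innerSL_apply_apply, real_inner_comm y z]
    congr 1
    push_cast
    ring
  have hder : ∀ n r, iteratedDeriv n h r = ((-2 * Real.pi : ℝ) * Complex.I) ^ n * h r := by
    intro n
    induction n with
    | zero => intro r; simp
    | succ n ih =>
      intro r
      rw [iteratedDeriv_succ, funext ih, pow_succ, deriv_const_mul_field, mul_assoc]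
      congr 1
      have h1 : HasDerivAt (fun r : ℝ => ((-2 * Real.pi : ℝ) * Complex.I) * (r : ℂ))
          (((-2 * Real.pi : ℝ) * Complex.I) * 1) r :=
        (Complex.ofRealCLM.hasDerivAt (x := r)).const_mul _
      have := h1.cexp.deriv
      rw [show deriv h r = _ from this]
      simp only [h]
      ring
  rw [heq, ContinuousLinearMap.iteratedFDeriv_comp_right ℓ hh y le_rfl]
  refine (ContinuousMultilinearMap.norm_compContinuousLinearMap_le _ _).trans ?_
  have h1 : ‖iteratedFDeriv ℝ n h (ℓ y)‖ = (2 * Real.pi) ^ n := by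
    rw [norm_iteratedFDeriv_eq_norm_iteratedDeriv, hder]
    have : ‖h (ℓ y)‖ = 1 := by
      simp only [h]
      rw [show ((-2 * Real.pi : ℝ) : ℂ) * Complex.I * ((ℓ y : ℝ) : ℂ)
        = ((-2 * Real.pi * ℓ y : ℝ) : ℂ) * Complex.I by push_cast; ring,
        Complex.norm_exp_ofReal_mul_I]
    rw [norm_mul, this, norm_pow, norm_mul, Complex.norm_I, Complex.norm_real]
    simp [abs_of_pos Real.pi_pos]
  have h2 : ‖ℓ‖ = ‖z‖ := innerSL_apply_norm _ _
  rw [h1, Finset.prod_const, h2, Finset.card_univ, Fintype.card_fin, mul_pow (2 * Real.pi)]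

theorem contDiff_phase_left (z : EuclideanSpace ℝ (Fin d)) :
    ContDiff ℝ ∞ (fun y => phase y z) := by
  unfold phase
  have : ContDiff ℝ ∞ (fun y : EuclideanSpace ℝ (Fin d) => ((inner ℝ y z : ℝ) : ℂ)) :=
    Complex.ofRealCLM.contDiff.comp (contDiff_id.inner ℝ contDiff_const)
  exact (contDiff_const.mul this).cexp

/-- A Fourier series over a uniformly discrete set of frequencies with coefficients of rapid
decay is smooth. -/
theorem UniformlyDiscrete.contDiff_tsum_phase (hL : UniformlyDiscrete L) {c : L → ℂ}
    (hc : ∀ k : ℕ, ∃ C, ∀ z : L, (1 + ‖(z : EuclideanSpace ℝ (Fin d))‖) ^ k * ‖c z‖ ≤ C) :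
    ContDiff ℝ ∞ (fun y : EuclideanSpace ℝ (Fin d) => ∑' z : L, phase y z * c z) := by
  choose C hC using hc
  refine contDiff_tsum (N := ⊤)
    (v := fun k (z : L) => (2 * Real.pi) ^ k * C (d + 1 + k) *
      ((1 + ‖(z : EuclideanSpace ℝ (Fin d))‖) ^ (d + 1))⁻¹)
    (fun z => (contDiff_phase_left _).mul contDiff_const)
    (fun k _ => hL.summable_one_add_norm_pow.mul_left _) fun k z y _ => ?_
  have h0 : (fun y => phase y (z : EuclideanSpace ℝ (Fin d)) * c z) =
      (c z) • fun y => phase y (z : EuclideanSpace ℝ (Fin d)) := by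
    funext y; simp [mul_comm]
  rw [h0, iteratedFDeriv_const_smul_apply
    (((contDiff_phase_left _).of_le (mod_cast le_top)).contDiffAt), norm_smul]
  rw [← div_eq_mul_inv, le_div_iff₀ (by positivity)]
  have h1 := norm_iteratedFDeriv_phase_le (z : EuclideanSpace ℝ (Fin d)) y k
  have h2 := hC (d + 1 + k) z
  set Z := ‖(z : EuclideanSpace ℝ (Fin d))‖ with hZ
  have hZ0 : 0 ≤ Z := norm_nonneg _
  calc ‖c z‖ * ‖iteratedFDeriv ℝ k (fun y => phase y (z : EuclideanSpace ℝ (Fin d))) y‖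
        * (1 + Z) ^ (d + 1)
      ≤ ‖c z‖ * (2 * Real.pi * (1 + Z)) ^ k * (1 + Z) ^ (d + 1) := by
        gcongr
        refine h1.trans ?_
        gcongr
        linarith
    _ = (2 * Real.pi) ^ k * ((1 + Z) ^ (d + 1 + k) * ‖c z‖) := by
        rw [mul_pow (2 * Real.pi), pow_add (1 + Z) (d + 1) k]; ring
    _ ≤ _ := by gcongr

/-- As a Fourier series in `y`, the pairing can be examined termwise, both for smoothness in `y` and
for holomorphy in a parameter of `ψ`. -/
theorem UniformlyDiscrete.formFactor_const_sub (hL : UniformlyDiscrete L)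
    (ψ : 𝓢(EuclideanSpace ℝ (Fin d), ℂ)) (y : EuclideanSpace ℝ (Fin d))
    (ψy : 𝓢(EuclideanSpace ℝ (Fin d), ℂ)) (hψ : ∀ x, ψy x = ψ (y - x)) :
    formFactor L ψy = ∑' z : L, phase y z * 𝓕 ψ (-z : EuclideanSpace ℝ (Fin d)) := by
  rw [hL.formFactor_apply, show (ψy : EuclideanSpace ℝ (Fin d) → ℂ) = fun x => ψ (y - x) from
    funext hψ]
  refine tsum_congr fun z => ?_
  rw [fourier_comp_const_sub]
  rfl

theorem UniformlyDiscrete.contDiff_formFactor_const_sub (hL : UniformlyDiscrete L)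
    (ψ : 𝓢(EuclideanSpace ℝ (Fin d), ℂ)) :
    ContDiff ℝ ∞ (fun y : EuclideanSpace ℝ (Fin d) =>
      ∑' z : L, phase y z * 𝓕 ψ (-z : EuclideanSpace ℝ (Fin d))) := by
  refine hL.contDiff_tsum_phase fun k => ⟨2 ^ k * ((Finset.Iic (k, 0)).sup
      (schwartzSeminormFamily ℂ (EuclideanSpace ℝ (Fin d)) ℂ)) (𝓕 ψ), fun z => ?_⟩
  have := (𝓕 ψ).one_add_norm_pow_mul_le k (-z : EuclideanSpace ℝ (Fin d))
  rwa [norm_neg] at this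

end Comb

/-! ### Regularized incomplete Gamma functions. -/

section IncompleteGamma

/-- The generalized exponential integral `∫_1^∞ t^{s-1} e^{-xt} dt`, for `x > 0`. -/
noncomputable def expIntegral (s : ℂ) (x : ℝ) : ℂ :=
  ∫ t in Ioi (1 : ℝ), (t : ℂ) ^ (s - 1) * (Real.exp (-(x * t)) : ℂ)

theorem integrableOn_rpow_mul_exp (M : ℝ) {x : ℝ} (hx : 0 < x) :
    IntegrableOn (fun t : ℝ => t ^ M * Real.exp (-(x * t))) (Ioi 1) := by
  refine integrable_of_isBigO_exp_neg (b := x / 2) (by positivity) ?_ ?_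
  · refine ContinuousOn.mul (ContinuousOn.rpow_const continuousOn_id fun t ht => ?_) (by fun_prop)
    exact Or.inl (ne_of_gt (lt_of_lt_of_le one_pos ht))
  · have h := (isLittleO_rpow_exp_pos_mul_atTop M (half_pos hx)).isBigO.mul
      (Asymptotics.isBigO_refl (fun t : ℝ => Real.exp (-(x * t))) atTop)
    refine h.congr_right fun t => ?_
    rw [← Real.exp_add]
    congr 1
    ring

theorem norm_cpow_mul_exp {t : ℝ} (ht : 0 < t) (s : ℂ) (x : ℝ) :
    ‖(t : ℂ) ^ (s - 1) * (Real.exp (-(x * t)) : ℂ)‖ = t ^ (s.re - 1) * Real.exp (-(x * t)) := by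
  rw [norm_mul, Complex.norm_cpow_eq_rpow_re_of_pos ht, Complex.norm_real, Real.norm_eq_abs,
    abs_of_pos (Real.exp_pos _), Complex.sub_re, Complex.one_re]

theorem continuousOn_cpow_mul_exp (s : ℂ) (x : ℝ) :
    ContinuousOn (fun t : ℝ => (t : ℂ) ^ s * (Real.exp (-(x * t)) : ℂ)) (Ioi 0) := by
  refine ContinuousOn.mul (fun t ht => ?_) (by fun_prop)
  exact (Complex.continuousAt_ofReal_cpow_const t s (Or.inr (ne_of_gt ht))).continuousWithinAt

theorem aestronglyMeasurable_cpow_mul_exp (s : ℂ) (x : ℝ) :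
    AEStronglyMeasurable (fun t : ℝ => (t : ℂ) ^ s * (Real.exp (-(x * t)) : ℂ))
      (volume.restrict (Ioi 1)) :=
  ((continuousOn_cpow_mul_exp s x).mono (Ioi_subset_Ioi zero_le_one)).aestronglyMeasurable
    measurableSet_Ioi

theorem integrableOn_cpow_mul_exp (s : ℂ) {x : ℝ} (hx : 0 < x) :
    IntegrableOn (fun t : ℝ => (t : ℂ) ^ (s - 1) * (Real.exp (-(x * t)) : ℂ)) (Ioi 1) := by
  refine (integrableOn_rpow_mul_exp (s.re - 1) hx).mono' (aestronglyMeasurable_cpow_mul_exp _ _) ?_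
  refine (ae_restrict_iff' measurableSet_Ioi).2 (Eventually.of_forall fun t ht => ?_)
  rw [norm_cpow_mul_exp (lt_trans one_pos ht)]

theorem norm_cpow_mul_exp_le {s : ℂ} {M : ℝ} (hs : s.re ≤ M) {t : ℝ} (ht : 1 < t) {x₀ x : ℝ}
    (hx : x₀ ≤ x) :
    ‖(t : ℂ) ^ (s - 1) * (Real.exp (-(x * t)) : ℂ)‖ ≤ t ^ (M - 1) * Real.exp (-(x₀ * t)) := by
  rw [norm_cpow_mul_exp (lt_trans one_pos ht)]
  gcongr
  exact ht.le

/-- Exponential decay of the exponential integral, uniformly in left half planes. -/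
theorem exists_norm_expIntegral_le (M : ℝ) {x₀ : ℝ} (hx₀ : 0 < x₀) :
    ∃ C : ℝ, 0 ≤ C ∧ ∀ s : ℂ, s.re ≤ M → ∀ x, x₀ ≤ x →
      ‖expIntegral s x‖ ≤ C * Real.exp (-(x / 2)) := by
  have hint := integrableOn_rpow_mul_exp (M - 1) (half_pos hx₀)
  refine ⟨∫ t in Ioi (1 : ℝ), t ^ (M - 1) * Real.exp (-(x₀ / 2 * t)), ?_, fun s hs x hx => ?_⟩
  · refine setIntegral_nonneg measurableSet_Ioi fun t ht => ?_
    have : 0 < t := lt_trans one_pos ht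
    positivity
  · rw [← integral_mul_const]
    refine norm_integral_le_of_norm_le (hint.mul_const _) ?_
    refine (ae_restrict_iff' measurableSet_Ioi).2 (Eventually.of_forall fun t ht => ?_)
    refine (norm_cpow_mul_exp_le hs ht le_rfl).trans ?_
    have ht' : (1 : ℝ) < t := ht
    -- Half of `xt` dominates `x₀t/2`, which keeps the integral finite; the other half dominates
    -- `x/2` because `t > 1`.
    rw [mul_assoc, ← Real.exp_add]
    gcongr
    nlinarith

theorem differentiable_expIntegral {x : ℝ} (hx : 0 < x) :
    Differentiable ℂ (fun s => expIntegral s x) := by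
  intro s₀
  refine differentiableAt_integral_of_dominated (Metric.ball_mem_nhds s₀ one_pos)
    (bound := fun t => t ^ (s₀.re + 1 - 1) * Real.exp (-(x * t)))
    (fun s _ => aestronglyMeasurable_cpow_mul_exp _ _) ?_ (integrableOn_rpow_mul_exp _ hx) ?_
  · refine (ae_restrict_iff' measurableSet_Ioi).2 (Eventually.of_forall fun t ht s hs => ?_)
    refine norm_cpow_mul_exp_le ?_ ht le_rfl
    have h1 := Complex.abs_re_le_norm (s - s₀)
    rw [Metric.mem_ball, dist_eq_norm] at hs
    rw [Complex.sub_re] at h1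
    linarith [le_abs_self (s.re - s₀.re)]
  · refine (ae_restrict_iff' measurableSet_Ioi).2 (Eventually.of_forall fun t ht => ?_)
    have ht' : (t : ℂ) ≠ 0 := by exact_mod_cast (ne_of_gt (lt_trans one_pos ht))
    refine Differentiable.differentiableOn ?_
    intro s
    exact ((differentiableAt_id.sub_const 1).const_cpow (Or.inl ht')).mul_const _

theorem hasDerivAt_expIntegral (s : ℂ) {x : ℝ} (hx : 0 < x) :
    HasDerivAt (expIntegral s) (-expIntegral (s + 1) x) x := by
  have h := (hasDerivAt_integral_of_dominated_loc_of_deriv_le (𝕜 := ℝ)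
    (μ := volume.restrict (Ioi (1 : ℝ))) (x₀ := x)
    (F := fun x t => (t : ℂ) ^ (s - 1) * (Real.exp (-(x * t)) : ℂ))
    (F' := fun x t => -((t : ℂ) ^ (s + 1 - 1) * (Real.exp (-(x * t)) : ℂ)))
    (bound := fun t => t ^ (s.re + 1 - 1) * Real.exp (-(x / 2 * t)))
    (Ioi_mem_nhds (half_lt_self hx))
    (Eventually.of_forall fun _ => aestronglyMeasurable_cpow_mul_exp _ _)
    (integrableOn_cpow_mul_exp s hx) (aestronglyMeasurable_cpow_mul_exp _ _).neg ?_
    (integrableOn_rpow_mul_exp _ (half_pos hx)) ?_).2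
  · rw [integral_neg] at h
    exact h
  · refine (ae_restrict_iff' measurableSet_Ioi).2 (Eventually.of_forall fun t ht y hy => ?_)
    rw [norm_neg]
    exact norm_cpow_mul_exp_le (by simp) ht (le_of_lt hy)
  · refine (ae_restrict_iff' measurableSet_Ioi).2 (Eventually.of_forall fun t ht y _ => ?_)
    have ht' : (t : ℂ) ≠ 0 := by exact_mod_cast (ne_of_gt (lt_trans one_pos ht))
    have h1 : HasDerivAt (fun y : ℝ => Real.exp (-(y * t))) (Real.exp (-(y * t)) * -(1 * t)) y :=
      (((hasDerivAt_id y).mul_const t).neg).exp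
    have h2 := h1.ofReal_comp.const_mul ((t : ℂ) ^ (s - 1))
    refine h2.congr_deriv ?_
    rw [add_sub_right_comm, Complex.cpow_add _ _ ht', Complex.cpow_one]
    push_cast
    ring

/-- Integration by parts. -/
theorem mul_expIntegral_add_one (s : ℂ) {x : ℝ} (hx : 0 < x) :
    (x : ℂ) * expIntegral (s + 1) x = (Real.exp (-x) : ℂ) + s * expIntegral s x := by
  have hder : ∀ t ∈ Ioi (0 : ℝ), HasDerivAt
      (fun t : ℝ => (t : ℂ) ^ s * (Real.exp (-(x * t)) : ℂ))
      (s * ((t : ℂ) ^ (s - 1) * (Real.exp (-(x * t)) : ℂ)) -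
        x * ((t : ℂ) ^ (s + 1 - 1) * (Real.exp (-(x * t)) : ℂ))) t := by
    intro t ht
    have ht0 : (t : ℝ) ≠ 0 := ne_of_gt ht
    have h1 : HasDerivAt (fun t : ℝ => Real.exp (-(x * t))) (Real.exp (-(x * t)) * -(x * 1)) t :=
      (((hasDerivAt_id t).const_mul x).neg).exp
    have h2 : HasDerivAt (fun t : ℝ => (t : ℂ) ^ s) (s * (t : ℂ) ^ (s - 1)) t := by
      have h3 := (hasDerivAt_id (t : ℂ)).cpow_const (c := s) (Or.inl (by simpa using ht))
      simpa using h3.comp_ofReal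
    refine (h2.mul h1.ofReal_comp).congr_deriv ?_
    rw [add_sub_cancel_right]
    push_cast
    ring
  have hlim : Tendsto (fun t : ℝ => (t : ℂ) ^ s * (Real.exp (-(x * t)) : ℂ)) atTop (𝓝 0) := by
    rw [tendsto_zero_iff_norm_tendsto_zero]
    have h := tendsto_rpow_mul_exp_neg_mul_atTop_nhds_zero s.re x hx
    refine h.congr' ?_
    filter_upwards [eventually_gt_atTop 0] with t ht
    have h4 := norm_cpow_mul_exp ht (s + 1) x
    simp only [add_sub_cancel_right, Complex.add_re, Complex.one_re] at h4
    rw [h4, neg_mul]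
  have hint1 := (integrableOn_cpow_mul_exp s hx).const_mul s
  have hint2 := (integrableOn_cpow_mul_exp (s + 1) hx).const_mul (x : ℂ)
  have h := integral_Ioi_of_hasDerivAt_of_tendsto
    ((hder 1 (mem_Ioi.2 one_pos)).continuousAt.continuousWithinAt)
    (fun t ht => hder t (mem_Ioi.2 (lt_trans one_pos (mem_Ioi.1 ht)))) (hint1.sub hint2) hlim
  have h5 : ∫ t in Ioi (1 : ℝ), (s * ((t : ℂ) ^ (s - 1) * (Real.exp (-(x * t)) : ℂ)) -
        x * ((t : ℂ) ^ (s + 1 - 1) * (Real.exp (-(x * t)) : ℂ))) =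
      s * expIntegral s x - x * expIntegral (s + 1) x := by
    rw [integral_sub hint1 hint2, integral_const_mul, integral_const_mul]
    rfl
  rw [h5] at h
  simp only [Complex.ofReal_one, Complex.one_cpow, mul_one, one_mul, zero_sub] at h
  linear_combination -h

/-- `Γ(s, x) x^{-s} / Γ(s)`, with the value `-1 / Γ(s + 1)` at `x = 0`; entire in `s`. -/
noncomputable def regUpper (s : ℂ) (x : ℝ) : ℂ :=
  if x = 0 then -(Complex.Gamma (s + 1))⁻¹ else expIntegral s x * (Complex.Gamma s)⁻¹

/-- The entire incomplete Gamma function `γ(s, x) x^{-s} / Γ(s)`. -/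
noncomputable def regLower (s : ℂ) (x : ℝ) : ℂ :=
  (if x = 0 then 0 else (x : ℂ) ^ (-s)) - regUpper s x

theorem differentiable_regUpper {x : ℝ} (hx : 0 ≤ x) :
    Differentiable ℂ (fun s => regUpper s x) := by
  unfold regUpper
  split_ifs with h
  · exact (Complex.differentiable_one_div_Gamma.comp (differentiable_id.add_const 1)).neg
  · exact (differentiable_expIntegral (lt_of_le_of_ne hx (Ne.symm h))).mul
      Complex.differentiable_one_div_Gamma

theorem differentiable_regLower {x : ℝ} (hx : 0 ≤ x) :
    Differentiable ℂ (fun s => regLower s x) := by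
  unfold regLower
  refine Differentiable.sub ?_ (differentiable_regUpper hx)
  split_ifs with h
  · exact differentiable_const _
  · exact differentiable_neg.const_cpow (Or.inl (by exact_mod_cast h))

/-- Integration by parts divided by `Γ(s + 1)`. It trades a unit shift of `s` to the right for a
factor `x`, which carries bounds to the left. -/
theorem regLower_eq_add (s : ℂ) {x : ℝ} (hx : 0 ≤ x) :
    regLower s x = (Real.exp (-x) : ℂ) * (Complex.Gamma (s + 1))⁻¹ + x * regLower (s + 1) x := by
  unfold regLower regUpper
  split_ifs with h
  · simp [h]
  · have hx0 : (x : ℂ) ≠ 0 := by exact_mod_cast h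
    have h1 := mul_expIntegral_add_one s (lt_of_le_of_ne hx (Ne.symm h))
    rw [Complex.one_div_Gamma_eq_self_mul_one_div_Gamma_add_one s,
      show -s = -(s + 1) + 1 by ring, Complex.cpow_add _ _ hx0, Complex.cpow_one]
    linear_combination (Complex.Gamma (s + 1))⁻¹ * h1

/-- For `x > 0` this is the full Mellin integral minus its tail beyond `1`. For `x = 0` the integral
is `1/s = Γ(s)/Γ(s + 1)`, which is what the value of `regUpper` at `0` is made for. -/
theorem integral_Ioc_cpow_mul_exp {s : ℂ} (hs : 0 < s.re) {x : ℝ} (hx : 0 ≤ x) :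
    ∫ t in Ioc (0 : ℝ) 1, (t : ℂ) ^ (s - 1) * (Real.exp (-(x * t)) : ℂ) =
      Complex.Gamma s * regLower s x := by
  have hG : Complex.Gamma s ≠ 0 := Complex.Gamma_ne_zero_of_re_pos hs
  have hs0 : s ≠ 0 := fun h => by simp [h] at hs
  rcases hx.eq_or_lt with rfl | hx
  · simp only [zero_mul, neg_zero, Real.exp_zero, Complex.ofReal_one, mul_one]
    rw [← intervalIntegral.integral_of_le zero_le_one, integral_cpow (Or.inl (by simpa using hs))]
    simp only [regLower, regUpper, if_true]
    rw [Complex.Gamma_add_one s hs0]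
    simp only [sub_add_cancel, Complex.ofReal_one, Complex.one_cpow, Complex.ofReal_zero,
      Complex.zero_cpow hs0]
    field_simp
    ring
  · have h := Complex.integral_cpow_mul_exp_neg_mul_Ioi (a := s) (r := x) hs (by simpa using hx)
    have hcast : ∀ t : ℝ, Complex.exp (-((x : ℂ) * t)) = (Real.exp (-(x * t)) : ℂ) := by
      intro t; push_cast; rfl
    simp only [hcast] at h
    have hI : IntegrableOn (fun t : ℝ => (t : ℂ) ^ (s - 1) * (Real.exp (-(x * t)) : ℂ))
        (Ioc 0 1) := by
      have h1 : IntervalIntegrable (fun t : ℝ => (t : ℂ) ^ (s - 1)) volume 0 1 :=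
        intervalIntegral.intervalIntegrable_cpow' (by simpa using hs)
      have h2 := h1.mul_continuousOn (g := fun t : ℝ => (Real.exp (-(x * t)) : ℂ)) (by fun_prop)
      exact (intervalIntegrable_iff_integrableOn_Ioc_of_le zero_le_one).1 h2
    rw [← Ioc_union_Ioi_eq_Ioi (zero_le_one (α := ℝ)), setIntegral_union
      (Ioc_disjoint_Ioi le_rfl) measurableSet_Ioi hI (integrableOn_cpow_mul_exp s hx)] at h
    have h3 : (1 / (x : ℂ)) ^ s = (x : ℂ) ^ (-s) := by
      rw [one_div, Complex.inv_cpow _ _ (by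
        rw [Complex.arg_ofReal_of_nonneg hx.le]; exact Real.pi_pos.ne), Complex.cpow_neg]
    rw [h3] at h
    simp only [regLower, regUpper, if_neg hx.ne']
    rw [mul_sub, mul_left_comm _ (expIntegral s x), mul_inv_cancel₀ hG, mul_one,
      mul_comm (Complex.Gamma s), ← h]
    unfold expIntegral
    ring

theorem exists_norm_Gamma_inv_le (R : ℝ) :
    ∃ C : ℝ, 0 ≤ C ∧ ∀ s : ℂ, ‖s‖ ≤ R → ‖(Complex.Gamma s)⁻¹‖ ≤ C := by
  obtain ⟨C, hC⟩ := (isCompact_closedBall (0 : ℂ) R).exists_bound_of_continuousOn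
    Complex.differentiable_one_div_Gamma.continuous.continuousOn
  refine ⟨max C 0, le_max_right _ _, fun s hs => (hC s ?_).trans (le_max_left _ _)⟩
  simpa using hs

/-- On `Re s ≥ 1` the integrand over `(0, 1]` is at most `1`. Each unit step to the left uses the
recurrence and costs one factor `1 + x`; the radius grows by one since the recurrence is evaluated
at `s + 1`. -/
theorem exists_norm_regLower_le_of_re (N : ℕ) (R : ℝ) :
    ∃ C : ℝ, 0 ≤ C ∧ ∀ s : ℂ, ‖s‖ ≤ R → 1 - (N : ℝ) ≤ s.re → ∀ x : ℝ, 0 ≤ x →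
      ‖regLower s x‖ ≤ C * (1 + x) ^ N := by
  induction N generalizing R with
  | zero =>
    obtain ⟨C, hC0, hC⟩ := exists_norm_Gamma_inv_le R
    refine ⟨C, hC0, fun s hs hre x hx => ?_⟩
    simp only [CharP.cast_eq_zero, sub_zero] at hre
    have hre0 : 0 < s.re := by linarith
    have h := integral_Ioc_cpow_mul_exp hre0 hx
    have h1 : regLower s x = (Complex.Gamma s)⁻¹ *
        ∫ t in Ioc (0 : ℝ) 1, (t : ℂ) ^ (s - 1) * (Real.exp (-(x * t)) : ℂ) := by
      rw [h, inv_mul_cancel_left₀ (Complex.Gamma_ne_zero_of_re_pos hre0)]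
    have h2 : ‖∫ t in Ioc (0 : ℝ) 1, (t : ℂ) ^ (s - 1) * (Real.exp (-(x * t)) : ℂ)‖ ≤
        1 * volume.real (Ioc (0 : ℝ) 1) := by
      refine norm_setIntegral_le_of_norm_le_const (by simp) fun t ht => ?_
      rw [norm_cpow_mul_exp ht.1]
      refine mul_le_one₀ (Real.rpow_le_one ht.1.le ht.2 (by linarith)) (Real.exp_pos _).le ?_
      rw [Real.exp_le_one_iff]
      nlinarith [ht.1]
    rw [h1, norm_mul, pow_zero]
    refine mul_le_mul (hC s hs) (h2.trans (by simp)) (norm_nonneg _) hC0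
  | succ N ih =>
    obtain ⟨C, hC0, hC⟩ := exists_norm_Gamma_inv_le (R + 1)
    obtain ⟨D, hD0, hD⟩ := ih (R + 1)
    refine ⟨C + D, by positivity, fun s hs hre x hx => ?_⟩
    have hs1 : ‖s + 1‖ ≤ R + 1 := (norm_add_le _ _).trans (by simpa using hs)
    have h1 := hC (s + 1) hs1
    have h2 := hD (s + 1) hs1 (by push_cast at hre; simp; linarith) x hx
    have h3 : Real.exp (-x) ≤ 1 := by rw [Real.exp_le_one_iff]; linarith
    have h4 : (1 : ℝ) ≤ (1 + x) ^ (N + 1) := one_le_pow₀ (by linarith)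
    rw [regLower_eq_add s hx]
    refine (norm_add_le _ _).trans ?_
    rw [norm_mul, norm_mul, Complex.norm_real, Complex.norm_real, Real.norm_eq_abs,
      Real.norm_eq_abs, abs_of_pos (Real.exp_pos _), abs_of_nonneg hx]
    calc Real.exp (-x) * ‖(Complex.Gamma (s + 1))⁻¹‖ + x * ‖regLower (s + 1) x‖
        ≤ 1 * C + (1 + x) * (D * (1 + x) ^ N) := by
          gcongr
          linarith
      _ = C * 1 + D * (1 + x) ^ (N + 1) := by ring
      _ ≤ C * (1 + x) ^ (N + 1) + D * (1 + x) ^ (N + 1) := by gcongr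
      _ = _ := by ring

/-- Polynomial growth of the lower incomplete Gamma function, locally uniformly in `s`. -/
theorem exists_norm_regLower_le (R : ℝ) :
    ∃ (N : ℕ) (C : ℝ), 0 ≤ C ∧ ∀ s : ℂ, ‖s‖ ≤ R → ∀ x : ℝ, 0 ≤ x →
      ‖regLower s x‖ ≤ C * (1 + x) ^ N := by
  obtain ⟨N, hN⟩ := exists_nat_ge (R + 1)
  obtain ⟨C, hC0, hC⟩ := exists_norm_regLower_le_of_re N R
  refine ⟨N, C, hC0, fun s hs x hx => hC s hs ?_ x hx⟩
  linarith [neg_le_of_abs_le ((Complex.abs_re_le_norm s).trans hs)]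

theorem measurable_regLower (s : ℂ) : Measurable (regLower s) := by
  have h1 : Measurable (expIntegral s) := by
    refine StronglyMeasurable.measurable ?_
    unfold expIntegral
    refine StronglyMeasurable.integral_prod_right
      (f := fun x t : ℝ => (t : ℂ) ^ (s - 1) * (Real.exp (-(x * t)) : ℂ)) ?_
    refine Measurable.stronglyMeasurable ?_
    unfold Function.uncurry
    fun_prop
  unfold regLower regUpper
  refine Measurable.sub ?_ ?_
  · exact Measurable.ite (measurableSet_singleton 0) measurable_const (by fun_prop)
  · exact Measurable.ite (measurableSet_singleton 0) measurable_const (h1.mul_const _)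

/-- The substitution `t ↦ xt` moves the lower limit to `1`, independently of `x`. -/
theorem upperGamma_div_cpow (s : ℂ) {x : ℝ} (hx : 0 < x) :
    upperGamma s x / (x : ℂ) ^ s = expIntegral s x := by
  have hx0 : (x : ℂ) ≠ 0 := by exact_mod_cast hx.ne'
  have h := integral_comp_mul_left_Ioi
    (fun t : ℝ => (t : ℂ) ^ (s - 1) * (Real.exp (-t) : ℂ)) 1 hx
  rw [mul_one] at h
  have h1 : upperGamma s x = x * ∫ t in Ioi (1 : ℝ),
      ((x * t : ℝ) : ℂ) ^ (s - 1) * (Real.exp (-(x * t)) : ℂ) := by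
    rw [h, Complex.real_smul, Complex.ofReal_inv, mul_inv_cancel_left₀ hx0]
    rfl
  rw [h1, div_eq_iff (by simp [Complex.cpow_eq_zero_iff, hx0]), expIntegral,
    ← integral_const_mul, ← integral_mul_const]
  refine setIntegral_congr_fun measurableSet_Ioi fun t ht => ?_
  rw [Complex.ofReal_mul, Complex.mul_cpow_ofReal_nonneg hx.le (lt_trans one_pos ht).le,
    Complex.cpow_sub _ _ hx0, Complex.cpow_one]
  field_simp

variable {d : ℕ}

theorem crandallG_of_ne_zero (ν : ℂ) {z : EuclideanSpace ℝ (Fin d)} (hz : z ≠ 0) :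
    crandallG ν z = expIntegral (ν / 2) (Real.pi * ‖z‖ ^ 2) := by
  have : 0 < ‖z‖ := norm_pos_iff.2 hz
  rw [crandallG, if_neg hz, upperGamma_div_cpow _ (by positivity)]

/-- At the origin this is `s Γ(s) = Γ(s + 1)`. It fails for `ν = 0`, where `-2 / ν` is `0` by
convention but `regUpper 0 0 = -1`. -/
theorem crandallG_mul_Gamma_inv {ν : ℂ} (hν : ν ≠ 0) (z : EuclideanSpace ℝ (Fin d)) :
    crandallG ν z * (Complex.Gamma (ν / 2))⁻¹ = regUpper (ν / 2) (Real.pi * ‖z‖ ^ 2) := by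
  by_cases hz : z = 0
  · subst hz
    rw [Complex.one_div_Gamma_eq_self_mul_one_div_Gamma_add_one (ν / 2)]
    simp only [crandallG, regUpper, if_true, norm_zero]
    norm_num
    field_simp
  · have : 0 < ‖z‖ := norm_pos_iff.2 hz
    rw [crandallG_of_ne_zero ν hz, regUpper, if_neg (by positivity)]

end IncompleteGamma

/-! ### The kernel as a superposition of Gaussians, and its Fourier transform. -/

section Kernel

variable {d : ℕ}

theorem expIntegral_zero {w : ℂ} (hw : w.re < 0) : expIntegral w 0 = -1 / w := by
  have h := integral_Ioi_cpow_of_lt (a := w - 1) (c := 1) (by simp; linarith) one_pos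
  simp only [expIntegral, zero_mul, neg_zero, Real.exp_zero, Complex.ofReal_one, mul_one]
  rw [h]
  simp

/-- For `Re ν > d` the integral still converges at the origin, and its value there is exactly the
prescribed `-2/(d - ν)`. -/
theorem crandallG_smul_eq {lam : ℝ} (hlam : 0 < lam) {ν : ℂ} {x : EuclideanSpace ℝ (Fin d)}
    (h : x ≠ 0 ∨ (d : ℝ) < ν.re) :
    crandallG ((d : ℂ) - ν) (lam • x) =
      expIntegral (((d : ℂ) - ν) / 2) (Real.pi * lam ^ 2 * ‖x‖ ^ 2) := by
  by_cases hx : x = 0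
  · have hν : (d : ℝ) < ν.re := h.resolve_left (not_not.2 hx)
    have hre : (((d : ℂ) - ν) / 2).re < 0 := by
      rw [Complex.div_ofNat_re]
      simp
      linarith
    have hne : (d : ℂ) - ν ≠ 0 := fun h0 => by simp [h0] at hre
    subst hx
    simp only [smul_zero, norm_zero, ne_eq, OfNat.ofNat_ne_zero, not_false_eq_true, zero_pow,
      mul_zero]
    rw [expIntegral_zero hre]
    simp only [crandallG, if_true]
    field_simp
  · rw [crandallG_of_ne_zero _ (smul_ne_zero hlam.ne' hx), norm_smul, Real.norm_eq_abs,
      abs_of_pos hlam]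
    congr 1
    ring

theorem crandallG_smul_ae_eq {lam : ℝ} (hlam : 0 < lam) {ν : ℂ} (hν : 0 < ν.re) :
    (fun x : EuclideanSpace ℝ (Fin d) => crandallG ((d : ℂ) - ν) (lam • x)) =ᵐ[volume]
      fun x => expIntegral (((d : ℂ) - ν) / 2) (Real.pi * lam ^ 2 * ‖x‖ ^ 2) := by
  -- For `d = 0` the origin is not a null set, but then the hypothesis already says `Re ν > d`.
  rcases Nat.eq_zero_or_pos d with rfl | hd
  · exact Eventually.of_forall fun x => crandallG_smul_eq hlam (Or.inr (by simpa using hν))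
  · have : Nonempty (Fin d) := ⟨⟨0, hd⟩⟩
    filter_upwards [Measure.ae_ne volume (0 : EuclideanSpace ℝ (Fin d))] with x hx
    exact crandallG_smul_eq hlam (Or.inl hx)

theorem integrable_gaussian {b : ℝ} (hb : 0 < b) :
    Integrable (fun x : EuclideanSpace ℝ (Fin d) => Real.exp (-b * ‖x‖ ^ 2)) := by
  have h := (GaussianFourier.integrable_cexp_neg_mul_sq_norm_add
    (V := EuclideanSpace ℝ (Fin d)) (b := b) (by simpa using hb) 0 0).norm
  refine h.congr (Eventually.of_forall fun x => ?_)
  simp only [zero_mul, add_zero]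
  rw [Complex.norm_exp]
  congr 1
  norm_cast

/-- The integrand of the kernel, as a function of the space and the Mellin variable. -/
noncomputable def kernelIntegrand (lam : ℝ) (ν : ℂ) (p : EuclideanSpace ℝ (Fin d) × ℝ) : ℂ :=
  (p.2 : ℂ) ^ (((d : ℂ) - ν) / 2 - 1) *
    (Real.exp (-(Real.pi * lam ^ 2 * ‖p.1‖ ^ 2 * p.2)) : ℂ)

/-- The Gaussian mass cancels the power `t^{d/2}`. What remains is integrable at infinity exactly
for `σ > 0`, hence the condition `Re ν > 0` for integrability of the kernel. -/
theorem rpow_mul_gaussian_integral {lam t : ℝ} (hlam : 0 < lam) (ht : 0 < t) (σ : ℝ) :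
    t ^ (((d : ℝ) - σ) / 2 - 1) * (Real.pi / (Real.pi * lam ^ 2 * t)) ^ ((d : ℝ) / 2) =
      (lam ^ d)⁻¹ * t ^ (-(σ / 2) - 1) := by
  have h1 : Real.pi / (Real.pi * lam ^ 2 * t) = (lam ^ 2)⁻¹ * t⁻¹ := by
    field_simp
  rw [h1, Real.mul_rpow (by positivity) (by positivity), Real.inv_rpow (by positivity),
    Real.inv_rpow ht.le, ← Real.rpow_natCast lam 2, ← Real.rpow_mul hlam.le,
    show ((2 : ℕ) : ℝ) * ((d : ℝ) / 2) = (d : ℝ) by push_cast; ring, Real.rpow_natCast,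
    mul_left_comm, ← Real.rpow_neg ht.le, ← Real.rpow_add ht]
  congr 2
  ring

theorem integrable_kernelIntegrand {lam : ℝ} (hlam : 0 < lam) {ν : ℂ} (hν : 0 < ν.re) :
    Integrable (kernelIntegrand (d := d) lam ν)
      ((volume : Measure (EuclideanSpace ℝ (Fin d))).prod (volume.restrict (Ioi (1 : ℝ)))) := by
  have hmeas : AEStronglyMeasurable (kernelIntegrand (d := d) lam ν)
      ((volume : Measure (EuclideanSpace ℝ (Fin d))).prod
        (volume.restrict (Ioi (1 : ℝ)))) := by
    refine Measurable.aestronglyMeasurable ?_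
    unfold kernelIntegrand
    fun_prop
  have hnorm : ∀ t ∈ Ioi (1 : ℝ), ∀ x : EuclideanSpace ℝ (Fin d),
      ‖kernelIntegrand lam ν (x, t)‖ = t ^ (((d : ℝ) - ν.re) / 2 - 1) *
        Real.exp (-(Real.pi * lam ^ 2 * t) * ‖x‖ ^ 2) := by
    intro t ht x
    unfold kernelIntegrand
    rw [norm_cpow_mul_exp (lt_trans one_pos ht)]
    congr 2
    · rw [Complex.div_ofNat_re]
      simp
    · ring
  rw [integrable_prod_iff' hmeas]
  constructor
  · refine (ae_restrict_iff' measurableSet_Ioi).2 (Eventually.of_forall fun t ht => ?_)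
    have ht0 : (0 : ℝ) < t := lt_trans one_pos ht
    have h1 := (integrable_gaussian (d := d) (b := Real.pi * lam ^ 2 * t) (by positivity)).const_mul
      (t ^ (((d : ℝ) - ν.re) / 2 - 1))
    refine h1.mono' ?_ (Eventually.of_forall fun x => (hnorm t ht x).le)
    refine Measurable.aestronglyMeasurable ?_
    unfold kernelIntegrand
    fun_prop
  · have h2 : IntegrableOn (fun t : ℝ => (lam ^ d)⁻¹ * t ^ (-(ν.re / 2) - 1)) (Ioi 1) :=
      (integrableOn_Ioi_rpow_of_lt (by linarith) one_pos).const_mul _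
    refine h2.congr_fun (fun t ht => ?_) measurableSet_Ioi
    have ht0 : (0 : ℝ) < t := lt_trans one_pos ht
    simp only
    rw [integral_congr_ae (Eventually.of_forall (hnorm t ht)), integral_const_mul,
      GaussianFourier.integral_rexp_neg_mul_sq_norm (by positivity), finrank_euclideanSpace_fin,
      rpow_mul_gaussian_integral hlam ht0]

theorem integrable_crandallG_smul {lam : ℝ} (hlam : 0 < lam) {ν : ℂ} (hν : 0 < ν.re) :
    Integrable (fun x : EuclideanSpace ℝ (Fin d) => crandallG ((d : ℂ) - ν) (lam • x)) := by
  refine (integrable_kernelIntegrand hlam hν).integral_prod_left.congr ?_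
  exact (crandallG_smul_ae_eq hlam hν).symm

/-- The inversion `t ↦ 1/t`, which exchanges the upper and the lower half of the Mellin integral. -/
theorem integral_Ioi_one_eq_integral_Ioc (s : ℂ) (X : ℝ) :
    ∫ t in Ioi (1 : ℝ), (t : ℂ) ^ (-s - 1) * (Real.exp (-(X * t⁻¹)) : ℂ) =
      ∫ t in Ioc (0 : ℝ) 1, (t : ℂ) ^ (s - 1) * (Real.exp (-(X * t)) : ℂ) := by
  have himg : (fun t : ℝ => t⁻¹) '' Ioi 1 = Ioo 0 1 := by
    have := Set.inv_Ioi₀ (a := (1 : ℝ)) one_pos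
    rw [inv_one] at this
    rw [← this]
    exact Set.image_inv_eq_inv
  have h := integral_image_eq_integral_abs_deriv_smul (s := Ioi (1 : ℝ)) (f := fun t : ℝ => t⁻¹)
    (f' := fun t => -(t ^ 2)⁻¹) measurableSet_Ioi
    (fun t ht => (hasDerivAt_inv (ne_of_gt (lt_trans one_pos (mem_Ioi.1 ht)))).hasDerivWithinAt)
    inv_injective.injOn (fun t : ℝ => (t : ℂ) ^ (s - 1) * (Real.exp (-(X * t)) : ℂ))
  rw [himg] at h
  rw [integral_Ioc_eq_integral_Ioo, h]
  refine setIntegral_congr_fun measurableSet_Ioi fun t ht => ?_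
  have ht0 : (0 : ℝ) < t := lt_trans one_pos ht
  have htc : (t : ℂ) ≠ 0 := by exact_mod_cast ht0.ne'
  simp only [abs_neg, Complex.real_smul]
  rw [abs_of_pos (by positivity), Complex.ofReal_inv t, Complex.inv_cpow _ _ (by
        rw [Complex.arg_ofReal_of_nonneg ht0.le]; exact Real.pi_pos.ne), ← Complex.cpow_neg,
    ← mul_assoc]
  congr 1
  rw [show -(s - 1) = (-s - 1) + 2 by ring, Complex.cpow_add _ _ htc, Complex.ofReal_inv,
    Complex.ofReal_pow, Complex.cpow_ofNat]
  field_simp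

/-- By Fubini each Gaussian is transformed separately. This replaces `t` by `1/t` in the exponent
and lowers the power of `t` by `d/2`; inversion of `t` then gives the lower incomplete Gamma
integral. -/
theorem fourier_crandallG_smul {lam : ℝ} (hlam : 0 < lam) {ν : ℂ} (hν : 0 < ν.re)
    (z : EuclideanSpace ℝ (Fin d)) :
    𝓕 (fun x : EuclideanSpace ℝ (Fin d) => crandallG ((d : ℂ) - ν) (lam • x)) z =
      ((lam : ℂ) ^ d)⁻¹ *
        (Complex.Gamma (ν / 2) * regLower (ν / 2) (Real.pi * ‖z‖ ^ 2 / lam ^ 2)) := by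
  have hs : 0 < (ν / 2).re := by
    rw [Complex.div_ofNat_re]
    positivity
  rw [← integral_Ioc_cpow_mul_exp hs (by positivity), ← integral_Ioi_one_eq_integral_Ioc,
    ← integral_const_mul, fourier_eq_integral_phase]
  have h1 : ∫ x, phase z x * crandallG ((d : ℂ) - ν) (lam • x) =
      ∫ x : EuclideanSpace ℝ (Fin d), ∫ t in Ioi (1 : ℝ),
        phase z x * kernelIntegrand lam ν (x, t) := by
    refine integral_congr_ae ?_
    filter_upwards [crandallG_smul_ae_eq hlam hν] with x hx
    rw [hx, integral_const_mul]
    rfl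
  rw [h1, integral_integral_swap]
  · refine setIntegral_congr_fun measurableSet_Ioi fun t ht => ?_
    have ht0 : (0 : ℝ) < t := lt_trans one_pos ht
    have htc : (t : ℂ) ≠ 0 := by exact_mod_cast ht0.ne'
    have h2 := fourier_gaussian_innerProductSpace (V := EuclideanSpace ℝ (Fin d))
      (b := ((Real.pi * lam ^ 2 * t : ℝ) : ℂ)) (by
        rw [Complex.ofReal_re]; positivity) z
    rw [fourier_eq_integral_phase] at h2
    have h3 : ∀ x : EuclideanSpace ℝ (Fin d), phase z x * kernelIntegrand lam ν (x, t) =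
        (t : ℂ) ^ (((d : ℂ) - ν) / 2 - 1) *
          (phase z x * Complex.exp (-((Real.pi * lam ^ 2 * t : ℝ) : ℂ) * ‖x‖ ^ 2)) := by
      intro x
      unfold kernelIntegrand
      rw [show (Real.exp (-(Real.pi * lam ^ 2 * ‖x‖ ^ 2 * t)) : ℂ) =
        Complex.exp (-((Real.pi * lam ^ 2 * t : ℝ) : ℂ) * ‖x‖ ^ 2) by
          rw [Complex.ofReal_exp]; congr 1; push_cast; ring]
      ring
    simp only [h3]
    rw [integral_const_mul, h2, finrank_euclideanSpace_fin]
    have h4 : Complex.exp (-(Real.pi : ℂ) ^ 2 * ‖z‖ ^ 2 / ((Real.pi * lam ^ 2 * t : ℝ) : ℂ)) =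
        (Real.exp (-(Real.pi * ‖z‖ ^ 2 / lam ^ 2 * t⁻¹)) : ℂ) := by
      rw [Complex.ofReal_exp]
      congr 1
      push_cast
      have : (lam : ℂ) ≠ 0 := by exact_mod_cast hlam.ne'
      have : (Real.pi : ℂ) ≠ 0 := by exact_mod_cast Real.pi_ne_zero
      field_simp
    have h5 : ((Real.pi : ℂ) / ((Real.pi * lam ^ 2 * t : ℝ) : ℂ)) ^ ((d : ℂ) / 2) =
        ((lam : ℂ) ^ d)⁻¹ * (t : ℂ) ^ (-((d : ℂ) / 2)) := by
      have h6 : (Real.pi : ℂ) / ((Real.pi * lam ^ 2 * t : ℝ) : ℂ) =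
          ((lam ^ 2 * t : ℝ) : ℂ)⁻¹ := by
        have : (lam : ℂ) ≠ 0 := by exact_mod_cast hlam.ne'
        have : (Real.pi : ℂ) ≠ 0 := by exact_mod_cast Real.pi_ne_zero
        push_cast
        field_simp
      rw [h6, Complex.inv_cpow _ _ (by
        rw [Complex.arg_ofReal_of_nonneg (by positivity)]; exact Real.pi_pos.ne),
        Complex.ofReal_mul, Complex.mul_cpow_ofReal_nonneg (by positivity) ht0.le, mul_inv,
        ← Complex.cpow_neg (t : ℂ)]
      congr 2
      rw [show ((lam ^ 2 : ℝ) : ℂ) ^ ((d : ℂ) / 2) = (((lam ^ 2) ^ ((d : ℝ) / 2) : ℝ) : ℂ) by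
        rw [Complex.ofReal_cpow (by positivity)]; push_cast; rfl, ← Complex.ofReal_pow]
      congr 1
      rw [← Real.rpow_natCast lam 2, ← Real.rpow_mul hlam.le,
        show ((2 : ℕ) : ℝ) * ((d : ℝ) / 2) = (d : ℝ) by push_cast; ring, Real.rpow_natCast]
    rw [h4, h5, show -(ν / 2) - 1 = (((d : ℂ) - ν) / 2 - 1) + -((d : ℂ) / 2) by ring,
      Complex.cpow_add _ _ htc]
    ring
  · have := (integrable_kernelIntegrand (d := d) hlam hν).bdd_mul
      (f := fun p : EuclideanSpace ℝ (Fin d) × ℝ => phase z p.1) (c := 1)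
      ((continuous_phase_right z).comp continuous_fst).aestronglyMeasurable
      (Eventually.of_forall fun p => by simp)
    exact this

end Kernel

/-! ### The kernel as a tempered distribution, meromorphic in `ν`. -/

section KernelDistribution

variable {d : ℕ}

theorem integrable_one_add_norm_pow_inv :
    Integrable (fun x : EuclideanSpace ℝ (Fin d) => ((1 + ‖x‖) ^ (d + 1))⁻¹) := by
  have h : Integrable (fun x : EuclideanSpace ℝ (Fin d) => (1 + ‖x‖) ^ (-((d + 1 : ℕ) : ℝ))) :=
    integrable_one_add_norm (by simp)
  refine h.congr (Eventually.of_forall fun x => ?_)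
  simp only
  rw [Real.rpow_neg (by positivity), Real.rpow_natCast]

theorem norm_mul_schwartz_le {m : EuclideanSpace ℝ (Fin d) → ℂ} {C : ℝ} {k : ℕ}
    (hb : ∀ z, ‖m z‖ ≤ C * (1 + ‖z‖) ^ k) (φ : 𝓢(EuclideanSpace ℝ (Fin d), ℂ))
    (z : EuclideanSpace ℝ (Fin d)) :
    ‖m z * φ z‖ ≤ C * (2 ^ (k + (d + 1)) * ((Finset.Iic (k + (d + 1), 0)).sup
      (schwartzSeminormFamily ℂ (EuclideanSpace ℝ (Fin d)) ℂ)) φ) * ((1 + ‖z‖) ^ (d + 1))⁻¹ := by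
  have hC : 0 ≤ C := by
    have := (norm_nonneg _).trans (hb 0)
    simpa using this
  rw [← div_eq_mul_inv, le_div_iff₀ (by positivity), norm_mul]
  have h1 := φ.one_add_norm_pow_mul_le (k + (d + 1)) z
  calc ‖m z‖ * ‖φ z‖ * (1 + ‖z‖) ^ (d + 1)
      ≤ C * (1 + ‖z‖) ^ k * ‖φ z‖ * (1 + ‖z‖) ^ (d + 1) := by
        gcongr
        exact hb z
    _ = C * ((1 + ‖z‖) ^ (k + (d + 1)) * ‖φ z‖) := by rw [pow_add]; ring
    _ ≤ _ := by gcongr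

theorem integrable_mul_schwartz {m : EuclideanSpace ℝ (Fin d) → ℂ} {C : ℝ} {k : ℕ}
    (hm : AEStronglyMeasurable m) (hb : ∀ z, ‖m z‖ ≤ C * (1 + ‖z‖) ^ k)
    (φ : 𝓢(EuclideanSpace ℝ (Fin d), ℂ)) : Integrable (fun z => m z * φ z) :=
  (integrable_one_add_norm_pow_inv.const_mul _).mono'
    (hm.mul φ.continuous.aestronglyMeasurable)
    (Eventually.of_forall (norm_mul_schwartz_le hb φ))

/-- A measurable function of polynomial growth acts on Schwartz functions by integration. -/
theorem exists_clm_integral_mul {m : EuclideanSpace ℝ (Fin d) → ℂ} {C : ℝ} {k : ℕ}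
    (hm : AEStronglyMeasurable m) (hb : ∀ z, ‖m z‖ ≤ C * (1 + ‖z‖) ^ k) :
    ∃ A : 𝓢(EuclideanSpace ℝ (Fin d), ℂ) →L[ℂ] ℂ, ∀ φ, A φ = ∫ z, m z * φ z := by
  have hC : 0 ≤ C := by
    have := (norm_nonneg _).trans (hb 0)
    simpa using this
  refine ⟨SchwartzMap.mkCLMtoNormedSpace (σ := RingHom.id ℂ) (fun φ => ∫ z, m z * φ z)
    (fun f g => ?_) (fun a f => ?_) ⟨Finset.Iic (k + (d + 1), 0), C * 2 ^ (k + (d + 1)) *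
      ∫ x : EuclideanSpace ℝ (Fin d), ((1 + ‖x‖) ^ (d + 1))⁻¹, ?_, fun f => ?_⟩, fun φ => rfl⟩
  · rw [← integral_add (integrable_mul_schwartz hm hb f) (integrable_mul_schwartz hm hb g)]
    refine integral_congr_ae (Eventually.of_forall fun z => ?_)
    simp [mul_add]
  · rw [RingHom.id_apply, ← integral_smul]
    refine integral_congr_ae (Eventually.of_forall fun z => ?_)
    simp [mul_left_comm]
  · exact mul_nonneg (by positivity) (integral_nonneg fun x => by positivity)
  · refine (norm_integral_le_of_norm_le (integrable_one_add_norm_pow_inv.const_mul _)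
      (Eventually.of_forall (norm_mul_schwartz_le hb f))).trans (le_of_eq ?_)
    rw [integral_const_mul]
    ring

theorem exists_norm_regLower_norm_sq_le {lam : ℝ} (hlam : 0 < lam) (R : ℝ) :
    ∃ (k : ℕ) (C : ℝ), ∀ ν : ℂ, ‖ν‖ ≤ R → ∀ z : EuclideanSpace ℝ (Fin d),
      ‖regLower (ν / 2) (Real.pi * ‖z‖ ^ 2 / lam ^ 2)‖ ≤ C * (1 + ‖z‖) ^ k := by
  obtain ⟨N, C, hC0, hC⟩ := exists_norm_regLower_le (R / 2)
  refine ⟨2 * N, C * (1 + Real.pi / lam ^ 2) ^ N, fun ν hν z => ?_⟩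
  refine (hC (ν / 2) (by rw [norm_div]; simpa using by linarith) _ (by positivity)).trans ?_
  rw [mul_assoc, pow_mul, ← mul_pow]
  gcongr
  have h1 : 0 < Real.pi / lam ^ 2 := by positivity
  have h2 := norm_nonneg z
  rw [mul_div_right_comm]
  nlinarith [mul_nonneg h1.le h2]

theorem measurable_regLower_norm_sq (lam : ℝ) (ν : ℂ) :
    Measurable (fun z : EuclideanSpace ℝ (Fin d) =>
      regLower (ν / 2) (Real.pi * ‖z‖ ^ 2 / lam ^ 2)) :=
  (measurable_regLower _).comp (by fun_prop)

/-- The kernel distribution divided by `Γ(ν/2)`, which is entire in `ν`. -/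
noncomputable def kernelReg (lam : ℝ) (ν : ℂ) (φ : EuclideanSpace ℝ (Fin d) → ℂ) : ℂ :=
  ((lam : ℂ) ^ d)⁻¹ *
    ∫ z : EuclideanSpace ℝ (Fin d), regLower (ν / 2) (Real.pi * ‖z‖ ^ 2 / lam ^ 2) * 𝓕 φ z

theorem differentiable_kernelReg {lam : ℝ} (hlam : 0 < lam)
    (φ : 𝓢(EuclideanSpace ℝ (Fin d), ℂ)) :
    Differentiable ℂ (fun ν => kernelReg lam ν φ) := by
  intro ν₀
  refine DifferentiableAt.const_mul ?_ _
  obtain ⟨k, C, hC⟩ := exists_norm_regLower_norm_sq_le (d := d) hlam (‖ν₀‖ + 1)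
  refine differentiableAt_integral_of_dominated (Metric.ball_mem_nhds ν₀ one_pos)
    (fun ν _ => ((measurable_regLower_norm_sq lam ν).aestronglyMeasurable).mul
      (𝓕 φ).continuous.aestronglyMeasurable)
    (Eventually.of_forall fun z ν hν => ?_) (integrable_one_add_norm_pow_inv.const_mul
      (C * (2 ^ (k + (d + 1)) * ((Finset.Iic (k + (d + 1), 0)).sup
      (schwartzSeminormFamily ℂ (EuclideanSpace ℝ (Fin d)) ℂ)) (𝓕 φ))))
    (Eventually.of_forall fun z => ?_)
  · refine norm_mul_schwartz_le (m := fun z => regLower (ν / 2) (Real.pi * ‖z‖ ^ 2 / lam ^ 2))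
      (hC ν ?_) (𝓕 φ) z
    rw [Metric.mem_ball, dist_eq_norm] at hν
    linarith [norm_le_norm_add_norm_sub' ν ν₀]
  · have h := differentiable_regLower (x := Real.pi * ‖z‖ ^ 2 / lam ^ 2) (by positivity)
    exact ((h.comp (differentiable_id.div_const 2)).mul_const _).differentiableOn

/-- The multiplication formula `∫ 𝓕G · h = ∫ G · 𝓕h` with `h = 𝓕⁻φ`; the sign in `𝓕⁻φ(z) = 𝓕φ(-z)`
disappears because the multiplier is even. -/
theorem Gamma_mul_kernelReg {lam : ℝ} (hlam : 0 < lam) {ν : ℂ} (hν : 0 < ν.re)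
    (φ : 𝓢(EuclideanSpace ℝ (Fin d), ℂ)) :
    Complex.Gamma (ν / 2) * kernelReg lam ν φ =
      ∫ x : EuclideanSpace ℝ (Fin d), crandallG ((d : ℂ) - ν) (lam • x) * φ x := by
  have h := VectorFourier.integral_fourierIntegral_smul_eq_flip (μ := volume) (ν := volume)
    (L := innerₗ (EuclideanSpace ℝ (Fin d))) (e := Real.fourierChar)
    (g := (𝓕⁻ φ : 𝓢(EuclideanSpace ℝ (Fin d), ℂ)))
    Real.continuous_fourierChar continuous_inner
    (integrable_crandallG_smul (d := d) hlam hν) (𝓕⁻ φ).integrable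
  rw [flip_innerₗ] at h
  have h1 : ∀ x : EuclideanSpace ℝ (Fin d),
      VectorFourier.fourierIntegral Real.fourierChar volume
        (innerₗ (EuclideanSpace ℝ (Fin d))) (𝓕⁻ φ : 𝓢(EuclideanSpace ℝ (Fin d), ℂ)) x = φ x := by
    intro x
    have h2 : 𝓕 (𝓕⁻ φ : 𝓢(EuclideanSpace ℝ (Fin d), ℂ)) = φ :=
      FourierTransform.fourier_fourierInv_eq φ
    conv_rhs => rw [← h2]
    rfl
  simp only [h1, smul_eq_mul] at h
  rw [← h]
  have h3 : ∀ z : EuclideanSpace ℝ (Fin d), VectorFourier.fourierIntegral Real.fourierChar volume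
        (innerₗ (EuclideanSpace ℝ (Fin d)))
        (fun x : EuclideanSpace ℝ (Fin d) => crandallG ((d : ℂ) - ν) (lam • x)) z *
        (𝓕⁻ φ : 𝓢(EuclideanSpace ℝ (Fin d), ℂ)) z =
      ((lam : ℂ) ^ d)⁻¹ * Complex.Gamma (ν / 2) *
        (regLower (ν / 2) (Real.pi * ‖-z‖ ^ 2 / lam ^ 2) *
          𝓕 (φ : EuclideanSpace ℝ (Fin d) → ℂ) (-z)) := by
    intro z
    have h4 := fourier_crandallG_smul (d := d) hlam hν z
    rw [show (𝓕⁻ φ : 𝓢(EuclideanSpace ℝ (Fin d), ℂ)) z =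
      𝓕 (φ : EuclideanSpace ℝ (Fin d) → ℂ) (-z) by
        rw [SchwartzMap.fourierInv_coe, Real.fourierInv_eq_fourier_neg], norm_neg]
    rw [show VectorFourier.fourierIntegral Real.fourierChar volume
        (innerₗ (EuclideanSpace ℝ (Fin d)))
        (fun x : EuclideanSpace ℝ (Fin d) => crandallG ((d : ℂ) - ν) (lam • x)) z = _ from h4]
    ring
  simp only [h3]
  rw [integral_const_mul, integral_neg_eq_self
    (fun z : EuclideanSpace ℝ (Fin d) => regLower (ν / 2) (Real.pi * ‖z‖ ^ 2 / lam ^ 2) *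
          𝓕 (φ : EuclideanSpace ℝ (Fin d) → ℂ) z), kernelReg]
  ring

theorem integrable_crandallG_mul_schwartz {lam : ℝ} (hlam : 0 < lam) {ν : ℂ} (hν : 0 < ν.re)
    (φ : 𝓢(EuclideanSpace ℝ (Fin d), ℂ)) :
    Integrable (fun x : EuclideanSpace ℝ (Fin d) =>
      crandallG ((d : ℂ) - ν) (lam • x) * φ x) :=
  (integrable_crandallG_smul hlam hν).mul_bdd (c := SchwartzMap.seminorm ℝ 0 0 φ)
    φ.continuous.aestronglyMeasurable
    (Eventually.of_forall fun x => SchwartzMap.norm_le_seminorm ℝ φ x)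

theorem exists_kernelDistribution (d : ℕ) {lam : ℝ} (hlam : 0 < lam) :
    ∃ T : ℂ → 𝓢'(EuclideanSpace ℝ (Fin d), ℂ),
      ∀ ν φ, T ν φ = Complex.Gamma (ν / 2) * kernelReg lam ν φ := by
  have h : ∀ ν : ℂ, ∃ A : 𝓢(EuclideanSpace ℝ (Fin d), ℂ) →L[ℂ] ℂ, ∀ φ, A φ =
      ∫ z : EuclideanSpace ℝ (Fin d), regLower (ν / 2) (Real.pi * ‖z‖ ^ 2 / lam ^ 2) * φ z := by
    intro ν
    obtain ⟨k, C, hC⟩ := exists_norm_regLower_norm_sq_le (d := d) hlam ‖ν‖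
    exact exists_clm_integral_mul (measurable_regLower_norm_sq lam ν).aestronglyMeasurable
      (hC ν le_rfl)
  choose A hA using h
  refine ⟨fun ν => ContinuousLinearMap.toPointwiseConvergenceCLM ℂ (RingHom.id ℂ) _ ℂ
    ((Complex.Gamma (ν / 2) * ((lam : ℂ) ^ d)⁻¹) •
      (A ν ∘L FourierTransform.fourierCLM ℂ 𝓢(EuclideanSpace ℝ (Fin d), ℂ))), fun ν φ => ?_⟩
  have := hA ν (𝓕 φ)
  change (Complex.Gamma (ν / 2) * ((lam : ℂ) ^ d)⁻¹) • A ν (𝓕 φ) = _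
  rw [this, kernelReg, smul_eq_mul, mul_assoc]
  rfl

theorem isKernelDistribution_of_eq {lam : ℝ} (hlam : 0 < lam)
    {T : ℂ → 𝓢'(EuclideanSpace ℝ (Fin d), ℂ)}
    (hT : ∀ ν φ, T ν φ = Complex.Gamma (ν / 2) * kernelReg lam ν φ) :
    IsKernelDistribution lam T := by
  have hginv : Differentiable ℂ (fun ν : ℂ => (Complex.Gamma (ν / 2))⁻¹) :=
    Complex.differentiable_one_div_Gamma.comp (differentiable_id.div_const 2)
  intro φ
  -- As the inverse of the entire function `1/Γ(ν/2)`, the Gamma factor is meromorphic, and analytic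
  -- off the zeros of that function.
  have heq : (fun ν => T ν φ) = fun ν => ((Complex.Gamma (ν / 2))⁻¹)⁻¹ * kernelReg lam ν φ := by
    funext ν
    rw [hT, inv_inv]
  refine ⟨fun ν => ?_, fun ν hν => ?_, fun ν hν =>
    ⟨integrable_crandallG_mul_schwartz hlam hν φ, ?_⟩⟩
  · rw [heq]
    exact ((hginv.analyticAt ν).meromorphicAt.inv).mul
      ((differentiable_kernelReg hlam φ).analyticAt ν).meromorphicAt
  · rw [heq]
    refine ((hginv.analyticAt ν).inv ?_).mul ((differentiable_kernelReg hlam φ).analyticAt ν)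
    refine inv_ne_zero (Complex.Gamma_ne_zero fun m hm => hν m ?_)
    linear_combination 2 * hm
  · rw [hT, Gamma_mul_kernelReg hlam hν]

end KernelDistribution

/-! ### Radial profiles cut off near the origin. -/

section Cutoff

/-- A smooth function on the line which vanishes below `a` and is constant above `b`. -/
structure IsCutoff (a b : ℝ) (ρ : ℝ → ℝ) : Prop where
  contDiff : ContDiff ℝ ∞ ρ
  eq_zero : ∀ r < a, ρ r = 0
  eventually_const : ∃ c, ∀ r, b < r → ρ r = c

/-- Because any constant is allowed beyond `b`, the class is closed under differentiation and
inductions over derivatives stay inside it. -/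
theorem IsCutoff.deriv {a b : ℝ} {ρ : ℝ → ℝ} (h : IsCutoff a b ρ) : IsCutoff a b (deriv ρ) where
  contDiff := (contDiff_infty_iff_deriv.1 h.contDiff).2
  eq_zero r hr := by
    have : ρ =ᶠ[𝓝 r] fun _ => 0 := by
      filter_upwards [Iio_mem_nhds hr] with x hx using h.eq_zero x hx
    rw [this.deriv_eq, deriv_const]
  eventually_const := by
    obtain ⟨c, hc⟩ := h.eventually_const
    refine ⟨0, fun r hr => ?_⟩
    have : ρ =ᶠ[𝓝 r] fun _ => c := by
      filter_upwards [Ioi_mem_nhds hr] with x hx using hc x hx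
    rw [this.deriv_eq, deriv_const]

theorem IsCutoff.exists_bound {a b : ℝ} {ρ : ℝ → ℝ} (h : IsCutoff a b ρ) :
    ∃ C : ℝ, 0 ≤ C ∧ ∀ r, |ρ r| ≤ C := by
  obtain ⟨c, hc⟩ := h.eventually_const
  obtain ⟨C, hC⟩ := (isCompact_Icc (a := a) (b := b)).exists_bound_of_continuousOn
    h.contDiff.continuous.continuousOn
  refine ⟨max (max C |c|) 0, le_max_right _ _, fun r => ?_⟩
  rcases lt_or_ge r a with h1 | h1
  · simp [h.eq_zero r h1]
  rcases lt_or_ge b r with h2 | h2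
  · rw [hc r h2]
    exact (le_max_right _ _).trans (le_max_left _ _)
  · exact (hC r ⟨h1, h2⟩).trans ((le_max_left _ _).trans (le_max_left _ _))

/-- The exponential integral, cut off near the origin. -/
noncomputable def radialProfile (α : ℝ) (ρ : ℝ → ℝ) (μ : ℂ) (r : ℝ) : ℂ :=
  (ρ r : ℂ) * expIntegral μ (α * r)

variable {a b α : ℝ} {ρ : ℝ → ℝ}

/-- The derivative is again made of profiles, one with cutoff `ρ'` and one with `μ` raised by one.
Below `a` everything vanishes, so the singularity at `0` is never met. -/
theorem IsCutoff.hasDerivAt_radialProfile (ha : 0 < a) (hα : 0 < α) (h : IsCutoff a b ρ) (μ : ℂ)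
    (r : ℝ) :
    HasDerivAt (radialProfile α ρ μ)
      (radialProfile α (_root_.deriv ρ) μ r - α * radialProfile α ρ (μ + 1) r) r := by
  rcases lt_or_ge r a with hr | hr
  · have h1 : radialProfile α ρ μ =ᶠ[𝓝 r] fun _ => 0 := by
      filter_upwards [Iio_mem_nhds hr] with x hx
      simp [radialProfile, h.eq_zero x hx]
    have h2 : radialProfile α (_root_.deriv ρ) μ r - α * radialProfile α ρ (μ + 1) r = 0 := by
      simp [radialProfile, h.eq_zero r hr, h.deriv.eq_zero r hr]
    rw [h2]
    exact (hasDerivAt_const r (0 : ℂ)).congr_of_eventuallyEq h1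
  · have hr0 : 0 < r := lt_of_lt_of_le ha hr
    have h1 : HasDerivAt ρ (_root_.deriv ρ r) r :=
      ((h.contDiff.differentiable (by simp)) r).hasDerivAt
    have h2 : HasDerivAt (fun r => expIntegral μ (α * r))
        ((α * 1) • -expIntegral (μ + 1) (α * r)) r :=
      (hasDerivAt_expIntegral μ (mul_pos hα hr0)).scomp r ((hasDerivAt_id r).const_mul α)
    refine (h1.ofReal_comp.mul h2).congr_deriv ?_
    simp only [radialProfile, mul_one, Complex.real_smul]
    ring

theorem IsCutoff.deriv_radialProfile (ha : 0 < a) (hα : 0 < α) (h : IsCutoff a b ρ) (μ : ℂ) :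
    _root_.deriv (radialProfile α ρ μ) =
      radialProfile α (_root_.deriv ρ) μ - (α : ℂ) • radialProfile α ρ (μ + 1) := by
  funext r
  rw [(h.hasDerivAt_radialProfile ha hα μ r).deriv]
  rfl

theorem IsCutoff.contDiff_radialProfile (ha : 0 < a) (hα : 0 < α) (h : IsCutoff a b ρ) (μ : ℂ) :
    ContDiff ℝ ∞ (radialProfile α ρ μ) := by
  refine contDiff_infty.2 fun n => ?_
  induction n generalizing ρ μ with
  | zero =>
    refine contDiff_zero.2 (continuous_iff_continuousAt.2 fun r => ?_)
    exact (h.hasDerivAt_radialProfile ha hα μ r).continuousAt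
  | succ n ih =>
    push_cast
    refine contDiff_succ_iff_deriv.2
      ⟨fun r => (h.hasDerivAt_radialProfile ha hα μ r).differentiableAt, by simp, ?_⟩
    rw [h.deriv_radialProfile ha hα]
    exact (ih h.deriv μ).sub ((ih h (μ + 1)).const_smul (α : ℂ))

/-- The induction has to vary both `ρ` and `M`, since a derivative changes the cutoff and raises `μ`
by one. -/
theorem IsCutoff.exists_decay_radialProfile (ha : 0 < a) (hα : 0 < α) (h : IsCutoff a b ρ)
    (k n : ℕ) (M : ℝ) :
    ∃ C : ℝ, 0 ≤ C ∧ ∀ μ : ℂ, μ.re ≤ M → ∀ r : ℝ,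
      |r| ^ k * ‖iteratedDeriv n (radialProfile α ρ μ) r‖ ≤ C := by
  induction n generalizing ρ M with
  | zero =>
    obtain ⟨B, hB0, hB⟩ := h.exists_bound
    obtain ⟨C, hC0, hC⟩ := exists_norm_expIntegral_le M (mul_pos hα ha)
    -- The last factor bounds `r^k e^{-αr/2}`, by comparison with one term of the exponential
    -- series.
    refine ⟨B * C * (k.factorial * (2 / α) ^ k), by positivity, fun μ hμ r => ?_⟩
    rw [iteratedDeriv_zero]
    rcases lt_or_ge r a with hr | hr
    · simp only [radialProfile, h.eq_zero r hr, Complex.ofReal_zero, zero_mul, norm_zero, mul_zero]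
      positivity
    · have hr0 : 0 < r := lt_of_lt_of_le ha hr
      have h1 := hC μ hμ (α * r) (by gcongr)
      have h2 := Real.pow_div_factorial_le_exp (x := α * r / 2) (by positivity) k
      have h3 : r ^ k * Real.exp (-(α * r / 2)) ≤ k.factorial * (2 / α) ^ k := by
        rw [Real.exp_neg, ← div_eq_mul_inv, div_le_iff₀ (Real.exp_pos _)]
        calc r ^ k = k.factorial * (2 / α) ^ k * ((α * r / 2) ^ k / k.factorial) := by
              rw [div_pow, div_pow, mul_pow]
              field_simp
          _ ≤ _ := by gcongr
      rw [radialProfile, norm_mul, Complex.norm_real, Real.norm_eq_abs, abs_of_pos hr0]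
      calc r ^ k * (|ρ r| * ‖expIntegral μ (α * r)‖)
          ≤ r ^ k * (B * (C * Real.exp (-(α * r / 2)))) := by
            gcongr
            exact hB r
        _ = B * C * (r ^ k * Real.exp (-(α * r / 2))) := by ring
        _ ≤ _ := by gcongr
  | succ n ih =>
    obtain ⟨C, hC0, hC⟩ := ih h.deriv M
    obtain ⟨D, hD0, hD⟩ := ih h (M + 1)
    refine ⟨C + α * D, by positivity, fun μ hμ r => ?_⟩
    have hc1 : ContDiffAt ℝ n (radialProfile α (_root_.deriv ρ) μ) r :=
      ((h.deriv.contDiff_radialProfile ha hα μ).of_le (mod_cast le_top)).contDiffAt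
    have hc2 : ContDiffAt ℝ n (radialProfile α ρ (μ + 1)) r :=
      ((h.contDiff_radialProfile ha hα (μ + 1)).of_le (mod_cast le_top)).contDiffAt
    have hc3 : ContDiffAt ℝ n ((α : ℂ) • radialProfile α ρ (μ + 1)) r := hc2.const_smul (α : ℂ)
    rw [iteratedDeriv_succ', h.deriv_radialProfile ha hα, iteratedDeriv_sub hc1 hc3,
      iteratedDeriv_const_smul hc2]
    have h1 := hC μ hμ r
    have h2 := hD (μ + 1) (by simpa using hμ) r
    calc |r| ^ k * ‖iteratedDeriv n (radialProfile α (_root_.deriv ρ) μ) r -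
          (α : ℂ) • iteratedDeriv n (radialProfile α ρ (μ + 1)) r‖
        ≤ |r| ^ k * (‖iteratedDeriv n (radialProfile α (_root_.deriv ρ) μ) r‖ +
          α * ‖iteratedDeriv n (radialProfile α ρ (μ + 1)) r‖) := by
          gcongr
          refine (norm_sub_le _ _).trans ?_
          rw [norm_smul, Complex.norm_real, Real.norm_eq_abs, abs_of_pos hα]
      _ = |r| ^ k * ‖iteratedDeriv n (radialProfile α (_root_.deriv ρ) μ) r‖ +
          α * (|r| ^ k * ‖iteratedDeriv n (radialProfile α ρ (μ + 1)) r‖) := by ring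
      _ ≤ _ := by gcongr

theorem exists_schwartz_radialProfile (ha : 0 < a) (hα : 0 < α) (h : IsCutoff a b ρ) :
    ∃ K : ℂ → 𝓢(ℝ, ℂ), (∀ μ r, K μ r = radialProfile α ρ μ r) ∧
      ∀ (k n : ℕ) (M : ℝ), ∃ C : ℝ, 0 ≤ C ∧ ∀ μ : ℂ, μ.re ≤ M →
        SchwartzMap.seminorm ℂ k n (K μ) ≤ C := by
  refine ⟨fun μ => ⟨radialProfile α ρ μ, h.contDiff_radialProfile ha hα μ, fun k n => ?_⟩,
    fun μ r => rfl, fun k n M => ?_⟩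
  · obtain ⟨C, -, hC⟩ := h.exists_decay_radialProfile ha hα k n μ.re
    refine ⟨C, fun r => ?_⟩
    rw [norm_iteratedFDeriv_eq_norm_iteratedDeriv]
    exact hC μ le_rfl r
  · obtain ⟨C, hC0, hC⟩ := h.exists_decay_radialProfile ha hα k n M
    exact ⟨C, hC0, fun μ hμ => SchwartzMap.seminorm_le_bound' ℂ k n _ hC0 (hC μ hμ)⟩

end Cutoff

/-! ### The kernel away from the origin as a holomorphic Schwartz family. -/

section KernelAwayFromZero

variable {d : ℕ}

/-- The image of a bounded family of Schwartz functions under a continuous linear map decays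
uniformly. -/
theorem exists_uniform_decay_of_seminorm_le {ι : Type*} {K : ι → 𝓢(ℝ, ℂ)}
    (hK : ∀ k n : ℕ, ∃ C : ℝ, 0 ≤ C ∧ ∀ i, SchwartzMap.seminorm ℂ k n (K i) ≤ C)
    (Φ : 𝓢(ℝ, ℂ) →L[ℂ] 𝓢(EuclideanSpace ℝ (Fin d), ℂ)) (k : ℕ) :
    ∃ C : ℝ, ∀ i z, (1 + ‖z‖) ^ k * ‖Φ (K i) z‖ ≤ C := by
  choose B hB0 hB using hK
  have h1 : ∀ j : ℕ × ℕ, ∃ C : ℝ, ∀ i,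
      schwartzSeminormFamily ℂ (EuclideanSpace ℝ (Fin d)) ℂ j (Φ (K i)) ≤ C := by
    intro j
    let q : Seminorm ℂ 𝓢(ℝ, ℂ) :=
      (schwartzSeminormFamily ℂ (EuclideanSpace ℝ (Fin d)) ℂ j).comp Φ.toLinearMap
    have hq : Continuous q :=
      ((schwartz_withSeminorms ℂ (EuclideanSpace ℝ (Fin d)) ℂ).continuous_seminorm j).comp
        Φ.continuous
    obtain ⟨s, C, -, hC⟩ := Seminorm.bound_of_continuous (schwartz_withSeminorms ℂ ℝ ℂ) q hq
    refine ⟨C * ∑ m ∈ s, B m.1 m.2, fun i => (hC (K i)).trans ?_⟩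
    change (C : ℝ) * (s.sup (schwartzSeminormFamily ℂ ℝ ℂ)) (K i) ≤ _
    refine mul_le_mul_of_nonneg_left ?_ C.2
    refine Seminorm.finset_sup_apply_le (Finset.sum_nonneg fun m _ => hB0 _ _) fun m hm => ?_
    refine (hB m.1 m.2 i).trans ?_
    exact Finset.single_le_sum (f := fun m : ℕ × ℕ => B m.1 m.2) (fun m _ => hB0 _ _) hm
  choose D hD using h1
  refine ⟨2 ^ k * ∑ j ∈ Finset.Iic (k, 0), max (D j) 0, fun i z => ?_⟩
  refine ((Φ (K i)).one_add_norm_pow_mul_le k z).trans ?_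
  refine mul_le_mul_of_nonneg_left ?_ (by positivity)
  refine Seminorm.finset_sup_apply_le (Finset.sum_nonneg fun m _ => le_max_right _ _)
    fun m hm => ?_
  refine ((hD m i).trans (le_max_left (D m) 0)).trans ?_
  exact Finset.single_le_sum (f := fun m : ℕ × ℕ => max (D m) 0)
    (fun m _ => le_max_right _ _) hm

/-- The kernel `G_{d-ν}(lam ·)` multiplied by a radial cutoff which vanishes near the origin is a
Schwartz function, locally bounded in `ν`. -/
theorem exists_schwartz_kernel (d : ℕ) {a b lam : ℝ} {ρ : ℝ → ℝ} (ha : 0 < a) (hlam : 0 < lam)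
    (h : IsCutoff a b ρ) :
    ∃ ψ : ℂ → 𝓢(EuclideanSpace ℝ (Fin d), ℂ),
      (∀ ν x, ψ ν x = (ρ (‖x‖ ^ 2) : ℂ) * crandallG ((d : ℂ) - ν) (lam • x)) ∧
      (∀ x, Differentiable ℂ (fun ν => ψ ν x)) ∧
      (∀ (k : ℕ) (M : ℝ), ∃ C : ℝ, ∀ ν : ℂ, M ≤ ν.re → ∀ x, (1 + ‖x‖) ^ k * ‖ψ ν x‖ ≤ C) ∧
      (∀ (k : ℕ) (M : ℝ), ∃ C : ℝ, ∀ ν : ℂ, M ≤ ν.re → ∀ z, (1 + ‖z‖) ^ k * ‖𝓕 (ψ ν) z‖ ≤ C) := by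
  have hα : 0 < Real.pi * lam ^ 2 := by positivity
  obtain ⟨K, hK, hKb⟩ := exists_schwartz_radialProfile ha hα h
  -- Properness of `x ↦ ‖x‖²` makes the pullback `𝓢(ℝ) → 𝓢(ℝ^d)` continuous, so all estimates reduce
  -- to one variable.
  have hup : ∃ (k : ℕ) (C : ℝ), ∀ x : EuclideanSpace ℝ (Fin d),
      ‖x‖ ≤ C * (1 + ‖‖x‖ ^ 2‖) ^ k := by
    refine ⟨1, 1, fun x => ?_⟩
    rw [Real.norm_eq_abs, abs_of_nonneg (by positivity)]
    nlinarith [sq_nonneg (‖x‖ - 1)]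
  let Φ : 𝓢(ℝ, ℂ) →L[ℂ] 𝓢(EuclideanSpace ℝ (Fin d), ℂ) :=
    SchwartzMap.compCLM ℂ (Function.hasTemperateGrowth_norm_sq (EuclideanSpace ℝ (Fin d))) hup
  have hfam : ∀ M : ℝ, ∀ k n : ℕ, ∃ C : ℝ, 0 ≤ C ∧ ∀ i : {ν : ℂ // M ≤ ν.re},
      SchwartzMap.seminorm ℂ k n (K (((d : ℂ) - i) / 2)) ≤ C := by
    intro M k n
    obtain ⟨C, hC0, hC⟩ := hKb k n (((d : ℝ) - M) / 2)
    refine ⟨C, hC0, fun i => hC _ ?_⟩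
    rw [Complex.div_ofNat_re]
    have := i.2
    simp
    linarith
  have hval : ∀ ν x, Φ (K (((d : ℂ) - ν) / 2)) x =
      (ρ (‖x‖ ^ 2) : ℂ) * expIntegral (((d : ℂ) - ν) / 2) (Real.pi * lam ^ 2 * ‖x‖ ^ 2) :=
    fun ν x => hK _ _
  refine ⟨fun ν => Φ (K (((d : ℂ) - ν) / 2)), fun ν x => ?_, fun x => ?_, fun k M => ?_,
    fun k M => ?_⟩
  · rw [hval]
    by_cases hx : x = 0
    · simp [hx, h.eq_zero 0 ha]
    · rw [crandallG_smul_eq hlam (Or.inl hx)]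
  · simp only [hval]
    by_cases hx : x = 0
    · simp [hx, h.eq_zero 0 ha]
    · have hx' : 0 < ‖x‖ := norm_pos_iff.2 hx
      refine Differentiable.const_mul ?_ _
      exact (differentiable_expIntegral (by positivity)).comp
        (((differentiable_const _).sub differentiable_id).div_const 2)
  · obtain ⟨C, hC⟩ := exists_uniform_decay_of_seminorm_le (hfam M) Φ k
    exact ⟨C, fun ν hν x => hC ⟨ν, hν⟩ x⟩
  · obtain ⟨C, hC⟩ := exists_uniform_decay_of_seminorm_le (hfam M)
      (FourierTransform.fourierCLM ℂ 𝓢(EuclideanSpace ℝ (Fin d), ℂ) ∘L Φ) k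
    exact ⟨C, fun ν hν x => hC ⟨ν, hν⟩ x⟩

theorem differentiable_integral_mul_of_decay {ψ : ℂ → 𝓢(EuclideanSpace ℝ (Fin d), ℂ)}
    (hd : ∀ x, Differentiable ℂ (fun ν => ψ ν x))
    (hb : ∀ (k : ℕ) (M : ℝ), ∃ C : ℝ, ∀ ν : ℂ, M ≤ ν.re → ∀ x, (1 + ‖x‖) ^ k * ‖ψ ν x‖ ≤ C)
    {h : EuclideanSpace ℝ (Fin d) → ℂ} (hh : Continuous h) {B : ℝ} (hB : ∀ x, ‖h x‖ ≤ B) :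
    Differentiable ℂ (fun ν => ∫ x, h x * ψ ν x) := by
  intro ν₀
  obtain ⟨C, hC⟩ := hb (d + 1) (ν₀.re - 1)
  refine differentiableAt_integral_of_dominated (Metric.ball_mem_nhds ν₀ one_pos)
    (fun ν _ => (hh.mul (ψ ν).continuous).aestronglyMeasurable)
    (Eventually.of_forall fun x ν hν => ?_) (integrable_one_add_norm_pow_inv.const_mul (B * C))
    (Eventually.of_forall fun x => ((hd x).const_mul _).differentiableOn)
  have hre : ν₀.re - 1 ≤ ν.re := by
    have h1 := Complex.abs_re_le_norm (ν - ν₀)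
    rw [Metric.mem_ball, dist_eq_norm] at hν
    rw [Complex.sub_re] at h1
    linarith [neg_abs_le (ν.re - ν₀.re)]
  have h2 := hC ν hre x
  have hB0 : 0 ≤ B := (norm_nonneg _).trans (hB x)
  rw [norm_mul, ← div_eq_mul_inv, le_div_iff₀ (by positivity)]
  calc ‖h x‖ * ‖ψ ν x‖ * (1 + ‖x‖) ^ (d + 1) = ‖h x‖ * ((1 + ‖x‖) ^ (d + 1) * ‖ψ ν x‖) := by ring
    _ ≤ _ := mul_le_mul (hB x) h2 (by positivity) hB0

end KernelAwayFromZero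

/-! ### Evaluating the form factor on continuous functions. -/

section Mollification

variable {d : ℕ} {L : Set (EuclideanSpace ℝ (Fin d))}

theorem ContDiffOn.contDiff_mul_of_tsupport_subset {E : Type*} [NormedAddCommGroup E]
    [NormedSpace ℝ E] {n : WithTop ℕ∞} {f g : E → ℂ} {V : Set E} (hV : IsOpen V)
    (hf : ContDiffOn ℝ n f V) (hg : ContDiff ℝ n g) (hgV : tsupport g ⊆ V) :
    ContDiff ℝ n (fun x => f x * g x) := by
  refine contDiff_iff_contDiffAt.2 fun x => ?_
  by_cases hx : x ∈ tsupport g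
  · exact (hf.contDiffAt (hV.mem_nhds (hgV hx))).mul hg.contDiffAt
  · have : (fun x => f x * g x) =ᶠ[𝓝 x] fun _ => 0 := by
      filter_upwards [(notMem_tsupport_iff_eventuallyEq.1 hx)] with y hy
      simp [hy]
    exact contDiffAt_const.congr_of_eventuallyEq this

open scoped Convolution in
theorem fourier_bump_convolution (φ : ContDiffBump (0 : EuclideanSpace ℝ (Fin d)))
    {F : EuclideanSpace ℝ (Fin d) → ℂ} (hF : Integrable F) (z : EuclideanSpace ℝ (Fin d)) :
    𝓕 (φ.normed volume ⋆[ContinuousLinearMap.lsmul ℝ ℝ, volume] F) z =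
      (∫ t, φ.normed volume t • phase z t) * 𝓕 F z := by
  have h1 : (φ.normed volume ⋆[ContinuousLinearMap.lsmul ℝ ℝ, volume] F) =
      ((fun t => (φ.normed volume t : ℂ)) ⋆[ContinuousLinearMap.lsmul ℂ ℂ, volume] F) := by
    funext x
    simp only [convolution_def, ContinuousLinearMap.lsmul_apply, smul_eq_mul, Complex.real_smul]
  have hφ : Integrable (fun t => (φ.normed volume t : ℂ)) := φ.integrable_normed.ofReal
  rw [h1, Real.fourier_smul_convolution_eq hφ hF, smul_eq_mul,
    fourier_eq_integral_phase]
  congr 1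
  refine integral_congr_ae (Eventually.of_forall fun t => ?_)
  simp only [Complex.real_smul]
  ring

open scoped Convolution in
/-- The form factor may be evaluated by summation on a continuous function with compact support
in a set where it is smooth, as soon as the sum converges absolutely. -/
theorem UniformlyDiscrete.tsum_fourier_eq_integral (hL : UniformlyDiscrete L)
    {f : EuclideanSpace ℝ (Fin d) → ℂ} {V : Set (EuclideanSpace ℝ (Fin d))}
    (hf : IsSmoothFunctionOn (formFactor L) f V) {F : EuclideanSpace ℝ (Fin d) → ℂ}
    (hFc : Continuous F) (hFs : HasCompactSupport F) (hFV : tsupport F ⊆ V)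
    (hsum : Summable fun z : L => 𝓕 F (z : EuclideanSpace ℝ (Fin d))) :
    ∑' z : L, 𝓕 F (z : EuclideanSpace ℝ (Fin d)) = ∫ x, f x * F x := by
  obtain ⟨hV, hfV, hu⟩ := hf
  have hFi : Integrable F := hFc.integrable_of_hasCompactSupport hFs
  obtain ⟨δ, hδ, hδV⟩ := hFs.isCompact.exists_cthickening_subset_open hV hFV
  set K := Metric.cthickening δ (tsupport F) with hK
  have hKc : IsCompact K := hFs.isCompact.cthickening
  -- The outer radii tend to `0` and never exceed `δ`, so all mollified functions are supported in
  -- the compact set `K ⊆ V`.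
  let φ : ℕ → ContDiffBump (0 : EuclideanSpace ℝ (Fin d)) := fun n =>
    ⟨δ / (n + 1) / 2, δ / (n + 1), by positivity, half_lt_self (by positivity)⟩
  have hφ0 : Tendsto (fun n => (φ n).rOut) atTop (𝓝 0) :=
    tendsto_const_nhds.div_atTop (tendsto_atTop_add_const_right _ _ tendsto_natCast_atTop_atTop)
  have hφδ : ∀ n, (φ n).rOut ≤ δ := fun n =>
    div_le_self hδ.le (by linarith [(Nat.cast_nonneg n : (0 : ℝ) ≤ n)])
  let Fn : ℕ → EuclideanSpace ℝ (Fin d) → ℂ := fun n =>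
    ((φ n).normed volume ⋆[ContinuousLinearMap.lsmul ℝ ℝ, volume] F)
  have hFnK : ∀ n, tsupport (Fn n) ⊆ K := by
    intro n
    refine closure_minimal ?_ Metric.isClosed_cthickening
    refine (support_convolution_subset _).trans ?_
    rintro _ ⟨x, hx, y, hy, rfl⟩
    rw [(φ n).support_normed_eq] at hx
    refine Metric.mem_cthickening_of_dist_le _ y _ _ (subset_tsupport _ hy) ?_
    rw [mem_ball_zero_iff] at hx
    simpa using hx.le.trans (hφδ n)
  have hFns : ∀ n, HasCompactSupport (Fn n) := fun n =>
    hKc.of_isClosed_subset (isClosed_tsupport _) (hFnK n)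
  have hFnd : ∀ n, ContDiff ℝ ∞ (Fn n) := fun n =>
    (φ n).hasCompactSupport_normed.contDiff_convolution_left _ (φ n).contDiff_normed
      hFi.locallyIntegrable
  have hval : ∀ n, ∑' z : L, (∫ t, (φ n).normed volume t • phase (z : EuclideanSpace ℝ (Fin d)) t) *
      𝓕 F (z : EuclideanSpace ℝ (Fin d)) = ∫ x, f x * Fn n x := by
    intro n
    have h1 := hu ((hFns n).toSchwartzMap (hFnd n)) (hFns n) ((hFnK n).trans hδV)
    rw [hL.formFactor_apply] at h1
    refine Eq.trans (tsum_congr fun z => ?_) h1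
    exact (fourier_bump_convolution (φ n) hFi z).symm
  -- On the Fourier side mollifying multiplies by factors of modulus at most `1` that tend to `1`,
  -- so the assumed summability dominates.
  have hlim1 : Tendsto (fun n => ∑' z : L,
      (∫ t, (φ n).normed volume t • phase (z : EuclideanSpace ℝ (Fin d)) t) *
      𝓕 F (z : EuclideanSpace ℝ (Fin d))) atTop
      (𝓝 (∑' z : L, 𝓕 F (z : EuclideanSpace ℝ (Fin d)))) := by
    refine tendsto_tsum_of_dominated_convergence hsum.norm (fun z => ?_)
      (Eventually.of_forall fun n z => ?_)
    · have h2 := ContDiffBump.convolution_tendsto_right_of_continuous (μ := volume) hφ0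
        ((continuous_phase_right (z : EuclideanSpace ℝ (Fin d))).comp continuous_neg) 0
      have h3 : phase (z : EuclideanSpace ℝ (Fin d)) (-0) = 1 := by simp [phase]
      simp only [convolution_def, ContinuousLinearMap.lsmul_apply, Function.comp, zero_sub,
        neg_neg, h3] at h2
      simpa using h2.mul_const (𝓕 F (z : EuclideanSpace ℝ (Fin d)))
    · rw [norm_mul]
      refine mul_le_of_le_one_left (norm_nonneg _) ?_
      refine (norm_integral_le_integral_norm _).trans (le_of_eq ?_)
      rw [← (φ n).integral_normed (μ := volume)]
      refine integral_congr_ae (Eventually.of_forall fun t => ?_)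
      simp only [norm_smul, norm_phase, mul_one, Real.norm_eq_abs]
      exact abs_of_nonneg ((φ n).nonneg_normed t)
  obtain ⟨B, hB⟩ := hFs.exists_bound_of_continuous hFc
  obtain ⟨Cf, hCf⟩ := hKc.exists_bound_of_continuousOn (hfV.continuousOn.mono hδV)
  have hB0 : 0 ≤ B := (norm_nonneg _).trans (hB 0)
  have hlim2 : Tendsto (fun n => ∫ x, f x * Fn n x) atTop (𝓝 (∫ x, f x * F x)) := by
    refine tendsto_integral_of_dominated_convergence (K.indicator fun _ => Cf * (3 * B))
      (fun n => ?_) ?_ (fun n => Eventually.of_forall fun x => ?_)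
      (Eventually.of_forall fun x => ?_)
    · exact (hfV.contDiff_mul_of_tsupport_subset hV (hFnd n)
        ((hFnK n).trans hδV)).continuous.aestronglyMeasurable
    · exact (integrable_indicator_iff hKc.measurableSet).2 (integrableOn_const hKc.measure_ne_top)
    · by_cases hx : x ∈ K
      · rw [indicator_of_mem hx, norm_mul]
        refine mul_le_mul (hCf x hx) ?_ (norm_nonneg _) ((norm_nonneg _).trans (hCf x hx))
        -- `F` varies by at most `2B`, so its averages differ from it by at most `2B` and are
        -- bounded by `3B`.
        have h4 := ContDiffBump.dist_normed_convolution_le (φ := φ n) (μ := volume) (x₀ := x)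
          (ε := 2 * B) hFc.aestronglyMeasurable fun y _ => by
            rw [dist_eq_norm]
            linarith [norm_sub_le (F y) (F x), hB y, hB x]
        rw [dist_eq_norm] at h4
        have h5 := norm_le_norm_add_norm_sub' (Fn n x) (F x)
        linarith [hB x]
      · rw [indicator_of_notMem hx, image_eq_zero_of_notMem_tsupport fun h => hx (hFnK n h)]
        simp
    · exact (ContDiffBump.convolution_tendsto_right_of_continuous (μ := volume) hφ0 hFc x).const_mul
        (f x)
  refine tendsto_nhds_unique hlim1 ?_
  simp only [hval]
  exact hlim2

end Mollification

/-! ### The upper series, the zeta series and their termwise relation. -/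

section Sums

variable {d : ℕ} {L : Set (EuclideanSpace ℝ (Fin d))}

theorem eq_of_eq_on_half_plane {f g : ℂ → ℂ} (hf : Differentiable ℂ f) (hg : Differentiable ℂ g)
    (c : ℝ) (h : ∀ ν : ℂ, c < ν.re → f ν = g ν) : f = g := by
  refine AnalyticOnNhd.eq_of_eventuallyEq (z₀ := ((c + 1 : ℝ) : ℂ)) (fun z _ => hf.analyticAt z)
    (fun z _ => hg.analyticAt z) ?_
  have h1 : {ν : ℂ | c < ν.re} ∈ 𝓝 ((c + 1 : ℝ) : ℂ) :=
    (isOpen_lt continuous_const Complex.continuous_re).mem_nhds (by simp)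
  filter_upwards [h1] with ν hν using h ν hν

theorem UniformlyDiscrete.mono {L' : Set (EuclideanSpace ℝ (Fin d))} (hL : UniformlyDiscrete L)
    (h : L' ⊆ L) : UniformlyDiscrete L' := by
  obtain ⟨ε, hε, hs⟩ := hL
  exact ⟨ε, hε, fun x hx y hy => hs x (h hx) y (h hy)⟩

/-- The power is at most `k! e^{1+t}`, and `t - ct²` has maximum `1/(4c)`. -/
theorem one_add_pow_mul_exp_neg_sq_le (k : ℕ) {c : ℝ} (hc : 0 < c) {t : ℝ} (ht : 0 ≤ t) :
    (1 + t) ^ k * Real.exp (-(c * t ^ 2)) ≤ k.factorial * Real.exp (1 + 1 / (4 * c)) := by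
  have h1 := Real.pow_div_factorial_le_exp (x := 1 + t) (by positivity) k
  rw [div_le_iff₀ (by positivity)] at h1
  calc (1 + t) ^ k * Real.exp (-(c * t ^ 2))
      ≤ Real.exp (1 + t) * k.factorial * Real.exp (-(c * t ^ 2)) := by gcongr
    _ = k.factorial * Real.exp (1 + t + -(c * t ^ 2)) := by rw [Real.exp_add (1 + t)]; ring
    _ ≤ _ := by
        have h2 : t - c * t ^ 2 ≤ 1 / (4 * c) := by
          rw [le_div_iff₀ (by positivity)]
          nlinarith [sq_nonneg (2 * c * t - 1)]
        exact mul_le_mul_of_nonneg_left (Real.exp_le_exp.2 (by linarith)) (by positivity)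

/-- Rapid decay over a uniformly discrete set of the upper incomplete Gamma terms, locally
uniformly in `ν`. -/
theorem UniformlyDiscrete.exists_regUpper_decay (hL : UniformlyDiscrete L) {lam : ℝ}
    (hlam : 0 < lam) (R : ℝ) (k : ℕ) :
    ∃ C : ℝ, ∀ ν : ℂ, ‖ν‖ ≤ R → ∀ z : L, (1 + ‖(z : EuclideanSpace ℝ (Fin d))‖) ^ k *
      ‖regUpper (ν / 2) (Real.pi * ‖(z : EuclideanSpace ℝ (Fin d))‖ ^ 2 / lam ^ 2)‖ ≤ C := by
  obtain ⟨δ, hδ, hδL⟩ := hL.exists_norm_ge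
  obtain ⟨A, hA0, hA⟩ := exists_norm_Gamma_inv_le (R / 2 + 1)
  have hx₀ : 0 < Real.pi * δ ^ 2 / lam ^ 2 := by positivity
  obtain ⟨B, hB0, hB⟩ := exists_norm_expIntegral_le (R / 2) hx₀
  set c : ℝ := Real.pi / lam ^ 2 / 2 with hc
  have hc0 : 0 < c := by positivity
  -- The summand `A` covers the origin, the other one the remaining points. The half in `c` comes
  -- from the decay `e^{-x/2}` of the exponential integral.
  refine ⟨A + A * B * (k.factorial * Real.exp (1 + 1 / (4 * c))), fun ν hν z => ?_⟩
  have hν2 : ‖ν / 2‖ ≤ R / 2 := by rw [norm_div]; simpa using by linarith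
  obtain ⟨z, hz⟩ := z
  simp only
  by_cases h0 : z = 0
  · subst h0
    have h1 := hA (ν / 2 + 1) ((norm_add_le _ _).trans (by simpa using by linarith))
    simp only [norm_zero, add_zero, one_pow, one_mul, ne_eq, OfNat.ofNat_ne_zero,
      not_false_eq_true, zero_pow, mul_zero, zero_div, regUpper, if_true, norm_neg]
    have : 0 ≤ A * B * (k.factorial * Real.exp (1 + 1 / (4 * c))) := by positivity
    linarith
  · have hz0 : 0 < ‖z‖ := norm_pos_iff.2 h0
    have h1 := hA (ν / 2) (hν2.trans (by linarith))
    have h2 := hB (ν / 2) ((Complex.re_le_norm _).trans hν2) (Real.pi * ‖z‖ ^ 2 / lam ^ 2) (by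
      gcongr
      exact hδL z hz h0)
    have h3 := one_add_pow_mul_exp_neg_sq_le k hc0 hz0.le
    rw [regUpper, if_neg (by positivity), norm_mul]
    calc (1 + ‖z‖) ^ k * (‖expIntegral (ν / 2) (Real.pi * ‖z‖ ^ 2 / lam ^ 2)‖ *
          ‖(Complex.Gamma (ν / 2))⁻¹‖)
        ≤ (1 + ‖z‖) ^ k * ((B * Real.exp (-(Real.pi * ‖z‖ ^ 2 / lam ^ 2 / 2))) * A) := by gcongr
      _ = A * B * ((1 + ‖z‖) ^ k * Real.exp (-(c * ‖z‖ ^ 2))) := by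
          rw [show Real.pi * ‖z‖ ^ 2 / lam ^ 2 / 2 = c * ‖z‖ ^ 2 by rw [hc]; ring]
          ring
      _ ≤ A * B * (k.factorial * Real.exp (1 + 1 / (4 * c))) := by gcongr
      _ ≤ _ := by linarith

/-- A series over a uniformly discrete set is entire if its terms are entire and decay, locally
uniformly in the parameter. -/
theorem UniformlyDiscrete.differentiable_tsum (hL : UniformlyDiscrete L) {c : ℂ → L → ℂ}
    (hd : ∀ z, Differentiable ℂ (fun ν => c ν z))
    (hc : ∀ ν₀ : ℂ, ∃ C : ℝ, ∀ ν ∈ Metric.ball ν₀ 1, ∀ z : L,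
      (1 + ‖(z : EuclideanSpace ℝ (Fin d))‖) ^ (d + 1) * ‖c ν z‖ ≤ C)
    (y : EuclideanSpace ℝ (Fin d)) :
    Differentiable ℂ (fun ν => ∑' z : L, phase y z * c ν z) := by
  intro ν₀
  obtain ⟨C, hC⟩ := hc ν₀
  refine (Complex.differentiableOn_tsum_of_summable_norm
    (hL.summable_one_add_norm_pow.mul_left C)
    (fun z => ((hd z).const_mul _).differentiableOn) Metric.isOpen_ball
    fun z ν hν => ?_).differentiableAt (Metric.ball_mem_nhds ν₀ one_pos)
  rw [norm_mul, norm_phase, one_mul, ← div_eq_mul_inv, le_div_iff₀ (by positivity), mul_comm]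
  exact hC ν hν z

theorem UniformlyDiscrete.summable_setZetaTerm (hL : UniformlyDiscrete L) {ν : ℂ}
    (hν : (d : ℝ) < ν.re) (y : EuclideanSpace ℝ (Fin d)) :
    Summable (fun z : ↥(L \ {0}) => setZetaTerm ν y (z : EuclideanSpace ℝ (Fin d))) := by
  obtain ⟨δ, hδ, hδL⟩ := hL.exists_norm_ge
  have hs := (hL.mono (sdiff_subset (t := {0}))).summable_one_add_norm_rpow hν
  have hν0 : 0 < ν.re := lt_of_le_of_lt (Nat.cast_nonneg d) hν
  -- Chosen so that `c (1 + ‖z‖) ≤ ‖z‖` whenever `‖z‖ ≥ δ`.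
  set c : ℝ := δ / (1 + δ) with hc
  have hc0 : 0 < c := by positivity
  refine Summable.of_norm_bounded (hs.mul_left (c ^ (-ν.re))) fun z => ?_
  have hz := hδL z z.2.1 z.2.2
  have hz0 : 0 < ‖(z : EuclideanSpace ℝ (Fin d))‖ := hδ.trans_le hz
  have h1 : ‖setZetaTerm ν y (z : EuclideanSpace ℝ (Fin d))‖ =
      ‖(z : EuclideanSpace ℝ (Fin d))‖ ^ (-ν.re) := by
    have : setZetaTerm ν y (z : EuclideanSpace ℝ (Fin d)) =
      phase y z / ((‖(z : EuclideanSpace ℝ (Fin d))‖ : ℝ) : ℂ) ^ ν := rfl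
    rw [this, norm_div, norm_phase, Complex.norm_cpow_eq_rpow_re_of_pos hz0,
      Real.rpow_neg hz0.le, one_div]
  rw [h1, ← Real.mul_rpow hc0.le (by positivity)]
  refine Real.rpow_le_rpow_of_nonpos (by positivity) ?_ (by linarith)
  rw [hc, div_mul_eq_mul_div, div_le_iff₀ (by positivity)]
  nlinarith

theorem tsum_diff_singleton_zero_eq (h : EuclideanSpace ℝ (Fin d) → ℂ) :
    ∑' z : ↥(L \ {0}), h z = ∑' z : L, ({0}ᶜ : Set (EuclideanSpace ℝ (Fin d))).indicator h z := by
  rw [tsum_subtype (L \ {0}) h, tsum_subtype L (({0}ᶜ : Set _).indicator h), indicator_indicator]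
  rfl

theorem summable_diff_singleton_zero_iff (h : EuclideanSpace ℝ (Fin d) → ℂ) :
    Summable (fun z : ↥(L \ {0}) => h z) ↔
      Summable (fun z : L => ({0}ᶜ : Set (EuclideanSpace ℝ (Fin d))).indicator h z) := by
  have h1 := summable_subtype_iff_indicator (f := h) (s := L \ {0})
  have h2 := summable_subtype_iff_indicator
    (f := ({0}ᶜ : Set (EuclideanSpace ℝ (Fin d))).indicator h) (s := L)
  rw [indicator_indicator] at h2
  exact h1.trans h2.symm

/-- The terms of the zeta function split into the two incomplete Gamma terms. -/
theorem phase_mul_regUpper_add_regLower {lam : ℝ} (hlam : 0 < lam) (ν : ℂ)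
    (y z : EuclideanSpace ℝ (Fin d)) :
    (Real.pi : ℂ) ^ (ν / 2) * (lam : ℂ) ^ (-ν) *
      (phase y z * regUpper (ν / 2) (Real.pi * ‖z‖ ^ 2 / lam ^ 2) +
        phase y z * regLower (ν / 2) (Real.pi * ‖z‖ ^ 2 / lam ^ 2)) =
      ({0}ᶜ : Set (EuclideanSpace ℝ (Fin d))).indicator (setZetaTerm ν y) z := by
  rw [← mul_add, regLower, add_sub_cancel]
  by_cases hz : z = 0
  · simp [hz]
  · have hz0 : 0 < ‖z‖ := norm_pos_iff.2 hz
    rw [indicator_of_mem (by simpa using hz), if_neg (by positivity)]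
    have h1 : ((Real.pi * ‖z‖ ^ 2 / lam ^ 2 : ℝ) : ℂ) ^ (-(ν / 2)) =
        (Real.pi : ℂ) ^ (-(ν / 2)) * ((‖z‖ : ℝ) : ℂ) ^ (-ν) * (lam : ℂ) ^ ν := by
      rw [div_eq_mul_inv, mul_assoc, ← inv_pow, ← mul_pow, Complex.ofReal_mul,
        Complex.mul_cpow_ofReal_nonneg Real.pi_pos.le (by positivity), mul_assoc]
      congr 1
      have h2 : ∀ {x : ℝ}, 0 < x → ((x ^ 2 : ℝ) : ℂ) ^ (-(ν / 2)) = (x : ℂ) ^ (-ν) := by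
        intro x hx
        have hxc : (x : ℂ) ≠ 0 := by exact_mod_cast hx.ne'
        rw [sq, Complex.ofReal_mul, Complex.mul_cpow_ofReal_nonneg hx.le hx.le,
          ← Complex.cpow_add _ _ hxc]
        congr 1
        ring
      rw [h2 (by positivity), Complex.ofReal_mul,
        Complex.mul_cpow_ofReal_nonneg hz0.le (by positivity)]
      congr 1
      rw [Complex.ofReal_inv, Complex.inv_cpow _ _ (by
        rw [Complex.arg_ofReal_of_nonneg hlam.le]; exact Real.pi_pos.ne), ← Complex.cpow_neg,
        neg_neg]
    have hpi : (Real.pi : ℂ) ≠ 0 := by exact_mod_cast Real.pi_ne_zero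
    have hl : (lam : ℂ) ≠ 0 := by exact_mod_cast hlam.ne'
    rw [h1, setZetaTerm, Complex.cpow_neg, Complex.cpow_neg, Complex.cpow_neg, phase]
    have h3 : (Real.pi : ℂ) ^ (ν / 2) ≠ 0 := by simp [Complex.cpow_eq_zero_iff, hpi]
    have h4 : (lam : ℂ) ^ ν ≠ 0 := by simp [Complex.cpow_eq_zero_iff, hl]
    field_simp

/-- For `Re ν > d` the power of `t` alone is integrable on `(1, ∞)`, which dominates the integrand
even at the origin. -/
theorem continuous_crandallG_smul {lam : ℝ} (hlam : 0 < lam) {ν : ℂ} (hν : (d : ℝ) < ν.re) :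
    Continuous (fun x : EuclideanSpace ℝ (Fin d) => crandallG ((d : ℂ) - ν) (lam • x)) := by
  simp only [crandallG_smul_eq hlam (Or.inr hν)]
  unfold expIntegral
  have hre : (((d : ℂ) - ν) / 2).re < 0 := by
    rw [Complex.div_ofNat_re]
    simp
    linarith
  refine continuous_of_dominated (bound := fun t => t ^ ((((d : ℂ) - ν) / 2).re - 1))
    (fun x => aestronglyMeasurable_cpow_mul_exp _ _) (fun x => ?_)
    (integrableOn_Ioi_rpow_of_lt (by linarith) one_pos) ?_
  · refine (ae_restrict_iff' measurableSet_Ioi).2 (Eventually.of_forall fun t ht => ?_)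
    have ht0 : (0 : ℝ) < t := lt_trans one_pos ht
    rw [norm_cpow_mul_exp ht0]
    refine mul_le_of_le_one_right (by positivity) ?_
    rw [Real.exp_le_one_iff]
    have : 0 ≤ Real.pi * lam ^ 2 * ‖x‖ ^ 2 * t := by positivity
    linarith
  · refine (ae_restrict_iff' measurableSet_Ioi).2 (Eventually.of_forall fun t ht => ?_)
    fun_prop

end Sums

/-! ### Smooth dependence on the point of reflection. -/

section Reflection

variable {d : ℕ}

theorem SchwartzMap.exists_const_sub (ψ : 𝓢(EuclideanSpace ℝ (Fin d), ℂ))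
    (y : EuclideanSpace ℝ (Fin d)) :
    ∃ ψy : 𝓢(EuclideanSpace ℝ (Fin d), ℂ), ∀ x, ψy x = ψ (y - x) := by
  refine ⟨SchwartzMap.compSubConstCLM ℂ y
    (SchwartzMap.compCLMOfContinuousLinearEquiv ℂ (ContinuousLinearEquiv.neg ℝ) ψ), fun x => ?_⟩
  simp

theorem kernelReg_sub {lam : ℝ} (hlam : 0 < lam) (ν : ℂ)
    (φ₁ φ₂ : 𝓢(EuclideanSpace ℝ (Fin d), ℂ)) :
    kernelReg lam ν (φ₁ - φ₂ : 𝓢(EuclideanSpace ℝ (Fin d), ℂ)) =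
      kernelReg lam ν φ₁ - kernelReg lam ν φ₂ := by
  obtain ⟨k, C, hC⟩ := exists_norm_regLower_norm_sq_le (d := d) hlam ‖ν‖
  have hm := (measurable_regLower_norm_sq (d := d) lam ν).aestronglyMeasurable (μ := volume)
  have h := integral_sub (integrable_mul_schwartz hm (hC ν le_rfl) (𝓕 φ₁))
    (integrable_mul_schwartz hm (hC ν le_rfl) (𝓕 φ₂))
  unfold kernelReg
  rw [← mul_sub]
  congr 1
  refine Eq.trans (integral_congr_ae (Eventually.of_forall fun z => ?_)) h
  have h2 : 𝓕 (φ₁ - φ₂) = 𝓕 φ₁ - 𝓕 φ₂ := map_sub (FourierTransform.fourierCLM ℂ _) φ₁ φ₂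
  have h3 := congrArg (fun φ : 𝓢(EuclideanSpace ℝ (Fin d), ℂ) => φ z) h2
  simp only [sub_apply] at h3
  rw [← mul_sub, ← h3]
  rfl

/-- Reflection and translation turn into a phase on the Fourier side, so this is the Fourier
transform of a function all of whose moments are integrable. -/
theorem contDiff_kernelReg_const_sub {lam : ℝ} (hlam : 0 < lam) (ν : ℂ)
    (φ : 𝓢(EuclideanSpace ℝ (Fin d), ℂ)) :
    ContDiff ℝ ∞ (fun y => kernelReg lam ν (fun x => φ (y - x))) := by
  obtain ⟨φn, hφn⟩ := (𝓕 φ).exists_const_sub 0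
  set m : EuclideanSpace ℝ (Fin d) → ℂ := fun z =>
    regLower (ν / 2) (Real.pi * ‖z‖ ^ 2 / lam ^ 2) * φn z with hm
  have heq : (fun y => kernelReg lam ν (fun x => φ (y - x))) =
      fun y => ((lam : ℂ) ^ d)⁻¹ * 𝓕 m y := by
    funext y
    rw [fourier_eq_integral_phase, kernelReg]
    congr 1
    refine integral_congr_ae (Eventually.of_forall fun z => ?_)
    simp only [hm]
    rw [fourier_comp_const_sub, hφn, zero_sub, SchwartzMap.fourier_coe]
    ring
  rw [heq]
  refine contDiff_const.mul (Real.contDiff_fourier (N := ⊤) fun n _ => ?_)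
  obtain ⟨k, C, hC⟩ := exists_norm_regLower_norm_sq_le (d := d) hlam ‖ν‖
  have h1 := integrable_mul_schwartz (k := n + k) (C := C)
    (m := fun z : EuclideanSpace ℝ (Fin d) =>
      ((‖z‖ ^ n : ℝ) : ℂ) * regLower (ν / 2) (Real.pi * ‖z‖ ^ 2 / lam ^ 2))
    ((Measurable.mul (by fun_prop) (measurable_regLower_norm_sq lam ν)).aestronglyMeasurable)
    (fun z => by
      have h2 := hC ν le_rfl z
      rw [norm_mul, Complex.norm_real, Real.norm_eq_abs, abs_of_nonneg (by positivity), pow_add]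
      calc ‖z‖ ^ n * ‖regLower (ν / 2) (Real.pi * ‖z‖ ^ 2 / lam ^ 2)‖
          ≤ (1 + ‖z‖) ^ n * (C * (1 + ‖z‖) ^ k) := by
            gcongr
            linarith
        _ = _ := by ring) φn
  refine h1.norm.congr (Eventually.of_forall fun z => ?_)
  simp only [hm, norm_mul, Complex.norm_real, Real.norm_eq_abs]
  rw [abs_of_nonneg (by positivity), mul_assoc]

theorem SchwartzMap.contDiff_integral_mul_const_sub (ψ φ : 𝓢(EuclideanSpace ℝ (Fin d), ℂ)) :
    ContDiff ℝ ∞ (fun y => ∫ x, ψ x * φ (y - x)) := by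
  have h : (fun y => ∫ x, ψ x * φ (y - x)) =
      SchwartzMap.convolution (ContinuousLinearMap.mul ℂ ℂ) ψ φ := by
    funext y
    rw [SchwartzMap.convolution_apply]
    rfl
  rw [h]
  exact SchwartzMap.smooth _ ⊤

end Reflection

/-! ### Localization near a regular point. -/

section LocalContinuation

variable {d : ℕ} {L : Set (EuclideanSpace ℝ (Fin d))}

theorem isCutoff_smoothTransition {a : ℝ} (ha : 0 < a) :
    IsCutoff a (2 * a) (fun r => Real.smoothTransition ((r - a) / a)) where
  contDiff := Real.smoothTransition.contDiff.comp ((contDiff_id.sub contDiff_const).div_const a)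
  eq_zero r hr := Real.smoothTransition.zero_of_nonpos
    (div_nonpos_of_nonpos_of_nonneg (by linarith) ha.le)
  eventually_const := ⟨1, fun r hr => Real.smoothTransition.one_of_one_le (by
    rw [one_le_div ha]; linarith)⟩

/-- A radial cutoff which is `1` near the origin and is supported in a given ball, such that
`1 - χ` is a cutoff function of the squared norm. -/
theorem exists_radial_cutoff (d : ℕ) {δ : ℝ} (hδ : 0 < δ) :
    ∃ (a b : ℝ) (ρ : ℝ → ℝ) (χ : EuclideanSpace ℝ (Fin d) → ℂ), 0 < a ∧ IsCutoff a b ρ ∧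
      (∀ x, 1 - χ x = (ρ (‖x‖ ^ 2) : ℂ)) ∧ ContDiff ℝ ∞ χ ∧ HasCompactSupport χ ∧
      tsupport χ ⊆ Metric.closedBall 0 δ := by
  -- The thresholds refer to the squared norm: `ρ` is `0` up to `δ²/2` and `1` from `δ²` on.
  have ha : 0 < δ ^ 2 / 2 := by positivity
  have hρ := isCutoff_smoothTransition ha
  set ρ : ℝ → ℝ := fun r => Real.smoothTransition ((r - δ ^ 2 / 2) / (δ ^ 2 / 2)) with hρd
  have hsupp : tsupport (fun x : EuclideanSpace ℝ (Fin d) => 1 - (ρ (‖x‖ ^ 2) : ℂ)) ⊆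
      Metric.closedBall 0 δ := by
    refine closure_minimal (fun x hx => ?_) Metric.isClosed_closedBall
    by_contra hxn
    rw [mem_closedBall_zero_iff, not_le] at hxn
    refine hx ?_
    have : ρ (‖x‖ ^ 2) = 1 := by
      refine Real.smoothTransition.one_of_one_le ?_
      rw [one_le_div ha]
      nlinarith
    simp [this]
  refine ⟨δ ^ 2 / 2, 2 * (δ ^ 2 / 2), ρ, fun x => 1 - (ρ (‖x‖ ^ 2) : ℂ), ha, hρ, fun x => by ring,
    contDiff_const.sub (Complex.ofRealCLM.contDiff.comp
      (hρ.contDiff.comp (contDiff_norm_sq ℝ))), ?_, hsupp⟩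
  exact (isCompact_closedBall _ _).of_isClosed_subset (isClosed_tsupport _) hsupp

/-- Near a regular point, a distribution is given by a smooth compactly supported function. -/
theorem exists_local_representative {u : 𝓢'(EuclideanSpace ℝ (Fin d), ℂ)}
    {y₀ : EuclideanSpace ℝ (Fin d)} (hy₀ : y₀ ∉ singSupp u) :
    ∃ (f : EuclideanSpace ℝ (Fin d) → ℂ) (V : Set (EuclideanSpace ℝ (Fin d))) (δ : ℝ)
      (g : 𝓢(EuclideanSpace ℝ (Fin d), ℂ)), 0 < δ ∧ IsSmoothFunctionOn u f V ∧
        Metric.ball y₀ (2 * δ) ⊆ V ∧ ∀ x ∈ Metric.ball y₀ (2 * δ), g x = f x := by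
  simp only [singSupp, mem_ofPred_eq, not_not] at hy₀
  obtain ⟨V, f, hyV, hf⟩ := hy₀
  obtain ⟨R, hR, hRV⟩ := Metric.isOpen_iff.1 hf.1 y₀ hyV
  let κ : ContDiffBump y₀ := ⟨R / 2, 3 * R / 4, by positivity, by linarith⟩
  have hκd : ContDiff ℝ ∞ (fun x => ((κ x : ℝ) : ℂ)) :=
    Complex.ofRealCLM.contDiff.comp κ.contDiff
  have hκs : tsupport (fun x => ((κ x : ℝ) : ℂ)) ⊆ Metric.closedBall y₀ (3 * R / 4) := by
    refine (closure_mono fun x hx => ?_).trans κ.tsupport_eq.subset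
    simpa using hx
  have hsub : tsupport (fun x => ((κ x : ℝ) : ℂ)) ⊆ V :=
    hκs.trans ((Metric.closedBall_subset_ball (by linarith)).trans hRV)
  have hcs : HasCompactSupport (fun x => f x * ((κ x : ℝ) : ℂ)) :=
    HasCompactSupport.mul_left
      ((isCompact_closedBall _ _).of_isClosed_subset (isClosed_tsupport _) hκs)
  refine ⟨f, V, R / 4, hcs.toSchwartzMap (hf.2.1.contDiff_mul_of_tsupport_subset hf.1 hκd hsub),
    by positivity, hf, (Metric.ball_subset_ball (by linarith)).trans hRV, fun x hx => ?_⟩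
  have h1 : κ x = 1 := κ.one_of_mem_closedBall
    (Metric.ball_subset_closedBall ((Metric.ball_subset_ball (by
      change 2 * (R / 4) ≤ R / 2
      linarith)) hx))
  change f x * ((κ x : ℝ) : ℂ) = f x
  rw [h1]
  simp

/-- Away from the origin, the kernel distribution is the Schwartz function `ψ`. -/
theorem kernelReg_eq_of_eq_cutoff_mul {lam : ℝ} (hlam : 0 < lam)
    {χ : EuclideanSpace ℝ (Fin d) → ℂ} {ψ : ℂ → 𝓢(EuclideanSpace ℝ (Fin d), ℂ)}
    (hψ : ∀ ν x, ψ ν x = (1 - χ x) * crandallG ((d : ℂ) - ν) (lam • x))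
    (hψd : ∀ x, Differentiable ℂ (fun ν => ψ ν x))
    (hψb : ∀ (k : ℕ) (M : ℝ), ∃ C : ℝ, ∀ ν : ℂ, M ≤ ν.re → ∀ x, (1 + ‖x‖) ^ k * ‖ψ ν x‖ ≤ C)
    {φ φ' : 𝓢(EuclideanSpace ℝ (Fin d), ℂ)} (h : ∀ x, φ' x = (1 - χ x) * φ x) (ν : ℂ) :
    kernelReg lam ν φ' = (Complex.Gamma (ν / 2))⁻¹ * ∫ x, ψ ν x * φ x := by
  have hd : Differentiable ℂ (fun ν => (Complex.Gamma (ν / 2))⁻¹ * ∫ x, ψ ν x * φ x) := by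
    refine Differentiable.mul
      (Complex.differentiable_one_div_Gamma.comp (differentiable_id.div_const 2)) ?_
    have := differentiable_integral_mul_of_decay hψd hψb φ.continuous
      (fun x => SchwartzMap.norm_le_seminorm ℝ φ x)
    simpa only [mul_comm] using this
  -- Both sides are entire in `ν`, and for `Re ν > 0` the kernel acts by integration, so there the
  -- identity is immediate.
  refine congrFun (eq_of_eq_on_half_plane (differentiable_kernelReg hlam φ') hd 0 fun ν hν => ?_) ν
  have hG : Complex.Gamma (ν / 2) ≠ 0 := Complex.Gamma_ne_zero_of_re_pos (by
    rw [Complex.div_ofNat_re]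
    positivity)
  rw [eq_inv_mul_iff_mul_eq₀ hG, Gamma_mul_kernelReg hlam hν]
  refine integral_congr_ae (Eventually.of_forall fun x => ?_)
  simp only [h, hψ]
  ring

/-- In the half plane of absolute convergence, the convolution with the kernel is a sum. -/
theorem UniformlyDiscrete.formFactor_add_integral_eq_tsum (hL : UniformlyDiscrete L) {lam : ℝ}
    (hlam : 0 < lam) {f : EuclideanSpace ℝ (Fin d) → ℂ} {V : Set (EuclideanSpace ℝ (Fin d))}
    (hf : IsSmoothFunctionOn (formFactor L) f V) {χ : EuclideanSpace ℝ (Fin d) → ℂ}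
    (hχ : Continuous χ) (hχs : HasCompactSupport χ) {y : EuclideanSpace ℝ (Fin d)}
    (hy : ∀ x ∈ tsupport χ, y - x ∈ V) {ν : ℂ} (hν : (d : ℝ) < ν.re)
    {ψ ψy : 𝓢(EuclideanSpace ℝ (Fin d), ℂ)}
    (hψ : ∀ x, ψ x = (1 - χ x) * crandallG ((d : ℂ) - ν) (lam • x))
    (hψy : ∀ x, ψy x = ψ (y - x))
    (hs : Summable fun z : L => phase y z *
      regLower (ν / 2) (Real.pi * ‖(z : EuclideanSpace ℝ (Fin d))‖ ^ 2 / lam ^ 2)) :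
    formFactor L ψy + ∫ x, crandallG ((d : ℂ) - ν) (lam • x) * (χ x * f (y - x)) =
      ((lam : ℂ) ^ d)⁻¹ * (Complex.Gamma (ν / 2) * ∑' z : L, phase y z *
        regLower (ν / 2) (Real.pi * ‖(z : EuclideanSpace ℝ (Fin d))‖ ^ 2 / lam ^ 2)) := by
  have hν0 : 0 < ν.re := lt_of_le_of_lt (Nat.cast_nonneg d) hν
  set G : EuclideanSpace ℝ (Fin d) → ℂ := fun x => crandallG ((d : ℂ) - ν) (lam • x) with hG
  have hGc : Continuous G := continuous_crandallG_smul hlam hν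
  have hGi : Integrable G := integrable_crandallG_smul hlam hν0
  set F : EuclideanSpace ℝ (Fin d) → ℂ := fun x => χ (y - x) * G (y - x) with hF
  have hrefl : Continuous (fun x : EuclideanSpace ℝ (Fin d) => y - x) := by fun_prop
  have hFc : Continuous F := (hχ.comp hrefl).mul (hGc.comp hrefl)
  have hFsupp : tsupport F ⊆ (fun x => y - x) ⁻¹' tsupport χ := by
    refine closure_minimal (fun x hx => ?_) ((isClosed_tsupport χ).preimage hrefl)
    refine subset_tsupport χ fun h0 => hx ?_
    simp only [hF]
    rw [h0, zero_mul]
  have hFs : HasCompactSupport F := by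
    refine IsCompact.of_isClosed_subset ?_ (isClosed_tsupport F) hFsupp
    have : (fun x => y - x) ⁻¹' tsupport χ = (fun x => y - x) '' tsupport χ := by
      ext x
      exact ⟨fun hx => ⟨y - x, hx, by simp⟩, by rintro ⟨w, hw, rfl⟩; simpa using hw⟩
    rw [this]
    exact hχs.isCompact.image hrefl
  have hFV : tsupport F ⊆ V := fun x hx => by
    have := hy _ (hFsupp hx)
    simpa using this
  -- `F` is the whole reflected kernel minus its Schwartz part, and both transforms are known.
  have hfour : ∀ z : EuclideanSpace ℝ (Fin d), 𝓕 F z = ((lam : ℂ) ^ d)⁻¹ *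
      (Complex.Gamma (ν / 2) *
        (phase y z * regLower (ν / 2) (Real.pi * ‖z‖ ^ 2 / lam ^ 2))) -
        𝓕 (ψy : EuclideanSpace ℝ (Fin d) → ℂ) z := by
    intro z
    have h1 : 𝓕 (fun x => G (y - x)) z = phase y z * 𝓕 G (-z) := fourier_comp_const_sub G y z
    rw [hG, fourier_crandallG_smul hlam hν0, norm_neg, ← hG] at h1
    have hint : ∀ {h : EuclideanSpace ℝ (Fin d) → ℂ}, Integrable h →
        Integrable (fun x => phase z x * h x) := fun hh =>
      hh.bdd_mul (c := 1) (continuous_phase_right z).aestronglyMeasurable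
        (Eventually.of_forall fun x => by simp)
    have h2 := integral_sub (hint (hGi.comp_sub_left y)) (hint ψy.integrable)
    rw [← fourier_eq_integral_phase, ← fourier_eq_integral_phase] at h2
    rw [fourier_eq_integral_phase, show ((lam : ℂ) ^ d)⁻¹ * (Complex.Gamma (ν / 2) *
        (phase y z * regLower (ν / 2) (Real.pi * ‖z‖ ^ 2 / lam ^ 2))) =
        𝓕 (fun x => G (y - x)) z by rw [h1]; ring, ← h2]
    refine integral_congr_ae (Eventually.of_forall fun x => ?_)
    simp only [hF, hψy, hψ, hG]
    ring
  have hs1 : Summable fun z : L => ((lam : ℂ) ^ d)⁻¹ * (Complex.Gamma (ν / 2) * (phase y z *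
      regLower (ν / 2) (Real.pi * ‖(z : EuclideanSpace ℝ (Fin d))‖ ^ 2 / lam ^ 2))) :=
    (hs.mul_left _).mul_left _
  have hs2 : Summable fun z : L => 𝓕 (ψy : EuclideanSpace ℝ (Fin d) → ℂ) z :=
    hL.summable_schwartz (𝓕 ψy)
  have hsum : Summable fun z : L => 𝓕 F (z : EuclideanSpace ℝ (Fin d)) := by
    simp only [hfour]
    exact hs1.sub hs2
  -- `F` is known only to be continuous, so it is not an admissible test function; hence the
  -- mollified version.
  have hkey := hL.tsum_fourier_eq_integral hf hFc hFs hFV hsum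
  simp only [hfour] at hkey
  rw [hs1.tsum_sub hs2, tsum_mul_left, tsum_mul_left, ← hL.formFactor_apply,
    ← integral_sub_left_eq_self _ volume y] at hkey
  have h3 : ∫ x, f (y - x) * F (y - x) = ∫ x, G x * (χ x * f (y - x)) := by
    refine integral_congr_ae (Eventually.of_forall fun x => ?_)
    simp only [hF, sub_sub_cancel]
    ring
  rw [h3] at hkey
  rw [← hkey]
  ring

end LocalContinuation

/-! ### Assembling the continuation. -/

section Main

variable {d : ℕ} {L : Set (EuclideanSpace ℝ (Fin d))}

theorem crandallG_inv_smul_eq {lam : ℝ} (hlam : 0 < lam) {ν : ℂ} (hν : ∀ n : ℕ, ν ≠ -2 * (n : ℂ))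
    (z : EuclideanSpace ℝ (Fin d)) :
    crandallG ν (lam⁻¹ • z) =
      Complex.Gamma (ν / 2) * regUpper (ν / 2) (Real.pi * ‖z‖ ^ 2 / lam ^ 2) := by
  have hG : Complex.Gamma (ν / 2) ≠ 0 := Complex.Gamma_ne_zero fun m hm => hν m (by
    linear_combination 2 * hm)
  have hν0 : ν ≠ 0 := by simpa using hν 0
  have h := crandallG_mul_Gamma_inv hν0 (lam⁻¹ • z)
  rw [norm_smul, Real.norm_eq_abs, abs_of_pos (inv_pos.2 hlam),
    show Real.pi * (lam⁻¹ * ‖z‖) ^ 2 = Real.pi * ‖z‖ ^ 2 / lam ^ 2 by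
      rw [mul_pow, inv_pow]; ring] at h
  rw [← h]
  field_simp

theorem UniformlyDiscrete.summable_phase_mul_regUpper (hL : UniformlyDiscrete L) {lam : ℝ}
    (hlam : 0 < lam) (ν : ℂ) (y : EuclideanSpace ℝ (Fin d)) :
    Summable (fun z : L => phase y z *
      regUpper (ν / 2) (Real.pi * ‖(z : EuclideanSpace ℝ (Fin d))‖ ^ 2 / lam ^ 2)) := by
  obtain ⟨C, hC⟩ := hL.exists_regUpper_decay hlam ‖ν‖ (d + 1)
  refine hL.summable_of_le (C := C) fun z => ?_
  rw [norm_mul, norm_phase, one_mul]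
  exact hC ν le_rfl z

/-- The sum of the two incomplete Gamma series is the zeta function. -/
theorem UniformlyDiscrete.regUpper_add_regLower_tsum (hL : UniformlyDiscrete L) {lam : ℝ}
    (hlam : 0 < lam) {ν : ℂ} (hν : (d : ℝ) < ν.re) (y : EuclideanSpace ℝ (Fin d)) :
    Summable (fun z : L => phase y z *
      regLower (ν / 2) (Real.pi * ‖(z : EuclideanSpace ℝ (Fin d))‖ ^ 2 / lam ^ 2)) ∧
    (Real.pi : ℂ) ^ (ν / 2) * (lam : ℂ) ^ (-ν) *
      ((∑' z : L, phase y z *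
        regUpper (ν / 2) (Real.pi * ‖(z : EuclideanSpace ℝ (Fin d))‖ ^ 2 / lam ^ 2)) +
      ∑' z : L, phase y z *
        regLower (ν / 2) (Real.pi * ‖(z : EuclideanSpace ℝ (Fin d))‖ ^ 2 / lam ^ 2)) =
      setZeta L ν y := by
  have hpi : (Real.pi : ℂ) ≠ 0 := by exact_mod_cast Real.pi_ne_zero
  have hl : (lam : ℂ) ≠ 0 := by exact_mod_cast hlam.ne'
  have hc : (Real.pi : ℂ) ^ (ν / 2) * (lam : ℂ) ^ (-ν) ≠ 0 := by
    simp [Complex.cpow_eq_zero_iff, hpi, hl]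
  have hU := hL.summable_phase_mul_regUpper hlam ν y
  have hsum := (summable_diff_singleton_zero_iff (setZetaTerm ν y)).1
    (hL.summable_setZetaTerm hν y)
  simp only [← phase_mul_regUpper_add_regLower hlam] at hsum
  have hUL := (summable_mul_left_iff hc).1 hsum
  -- Convergence of the lower series comes from that of the zeta and the upper series, not from a
  -- bound on its terms.
  have hLo : Summable (fun z : L => phase y z *
      regLower (ν / 2) (Real.pi * ‖(z : EuclideanSpace ℝ (Fin d))‖ ^ 2 / lam ^ 2)) := by
    simpa using hUL.sub hU
  refine ⟨hLo, ?_⟩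
  rw [setZeta, tsum_diff_singleton_zero_eq, ← hU.tsum_add hLo, ← tsum_mul_left]
  exact tsum_congr fun z => phase_mul_regUpper_add_regLower hlam ν y z

/-- The continuation of the zeta function near a point outside of the singular support. -/
theorem UniformlyDiscrete.exists_local_continuation (hL : UniformlyDiscrete L) {lam : ℝ}
    (hlam : 0 < lam) {T : ℂ → 𝓢'(EuclideanSpace ℝ (Fin d), ℂ)}
    (hT : ∀ ν φ, T ν φ = Complex.Gamma (ν / 2) * kernelReg lam ν φ)
    {y₀ : EuclideanSpace ℝ (Fin d)} (hy₀ : y₀ ∉ singSupp (formFactor L)) :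
    ∃ W ∈ 𝓝 y₀, ∃ E : ℂ → EuclideanSpace ℝ (Fin d) → ℂ,
      (∀ y ∈ W, Differentiable ℂ (fun ν => E ν y)) ∧
      (∀ y ∈ W, ∀ ν : ℂ, (d : ℝ) < ν.re → E ν y = setZeta L ν y) ∧
      (∀ y ∈ W, ∀ ν : ℂ, (∀ n : ℕ, ν ≠ -2 * (n : ℂ)) →
        ∃ c : ℂ, HasConvolutionAt (formFactor L) (T ν) y c ∧
          E ν y = (Real.pi : ℂ) ^ (ν / 2) / ((lam : ℂ) ^ ν * Complex.Gamma (ν / 2)) *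
            ((∑' z : L, phase y z * crandallG ν (lam⁻¹ • (z : EuclideanSpace ℝ (Fin d)))) +
              (lam : ℂ) ^ d * c)) ∧
      ∀ ν : ℂ, ContDiffOn ℝ ∞ (E ν) W := by
  obtain ⟨f, V, δ, g, hδ, hf, hVsub, hgf⟩ := exists_local_representative hy₀
  obtain ⟨a, b, ρ, χ, ha, hρ, hρχ, hχd, hχc, hχs⟩ := exists_radial_cutoff d hδ
  obtain ⟨ψ, hψ, hψd, hψb, hψF⟩ := exists_schwartz_kernel d ha hlam hρ
  simp only [← hρχ] at hψ
  choose ψr hψr using fun ν => (ψ ν).exists_const_sub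
  choose gr hgr using g.exists_const_sub
  have hχt : χ.HasTemperateGrowth := hχc.hasTemperateGrowth hχd
  -- Using the global representative `g` in place of `f` makes `F y` a Schwartz function for every
  -- `y`; it is `χ f(y - ·)` for `y` near `y₀`.
  let F : EuclideanSpace ℝ (Fin d) → 𝓢(EuclideanSpace ℝ (Fin d), ℂ) :=
    fun y => SchwartzMap.smulLeftCLM ℂ χ (gr y)
  have hmem : ∀ y ∈ Metric.ball y₀ δ, ∀ x ∈ tsupport χ, y - x ∈ Metric.ball y₀ (2 * δ) := by
    intro y hy x hx
    have hx' := hχs hx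
    rw [mem_closedBall_zero_iff] at hx'
    rw [mem_ball_iff_norm] at hy ⊢
    calc ‖y - x - y₀‖ = ‖(y - y₀) - x‖ := by congr 1; abel
      _ ≤ ‖y - y₀‖ + ‖x‖ := norm_sub_le _ _
      _ < 2 * δ := by linarith
  have hF0 : ∀ y x, F y x = χ x * g (y - x) := fun y x => by
    simp only [F]
    rw [SchwartzMap.smulLeftCLM_apply_apply hχt, hgr, smul_eq_mul]
  have hF : ∀ y ∈ Metric.ball y₀ δ, ∀ x, F y x = χ x * f (y - x) := by
    intro y hy x
    rw [hF0]
    by_cases hx : x ∈ tsupport χ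
    · rw [hgf _ (hmem y hy x hx)]
    · rw [image_eq_zero_of_notMem_tsupport hx, zero_mul, zero_mul]
  have hcut : ∀ {φ φ' : 𝓢(EuclideanSpace ℝ (Fin d), ℂ)}, (∀ x, φ' x = (1 - χ x) * φ x) →
      ∀ ν, kernelReg lam ν φ' = (Complex.Gamma (ν / 2))⁻¹ * ∫ x, ψ ν x * φ x :=
    fun h ν => kernelReg_eq_of_eq_cutoff_mul hlam hψ hψd hψb h ν
  have hginv : Differentiable ℂ (fun ν : ℂ => (Complex.Gamma (ν / 2))⁻¹) :=
    Complex.differentiable_one_div_Gamma.comp (differentiable_id.div_const 2)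
  have hpi : (Real.pi : ℂ) ≠ 0 := by exact_mod_cast Real.pi_ne_zero
  have hl : (lam : ℂ) ≠ 0 := by exact_mod_cast hlam.ne'
  have hball : ∀ ν₀ : ℂ, ∀ ν ∈ Metric.ball ν₀ 1, ‖ν‖ ≤ ‖ν₀‖ + 1 := by
    intro ν₀ ν hν
    rw [mem_ball_iff_norm] at hν
    linarith [norm_le_norm_add_norm_sub' ν ν₀]
  -- The division by `Γ(ν/2)` is carried out inside every summand, which leaves entire functions,
  -- also at `ν = 0, -2, -4, …`.
  refine ⟨Metric.ball y₀ δ, Metric.ball_mem_nhds y₀ hδ, fun ν y =>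
    (Real.pi : ℂ) ^ (ν / 2) * (lam : ℂ) ^ (-ν) * ((∑' z : L, phase y z *
      regUpper (ν / 2) (Real.pi * ‖(z : EuclideanSpace ℝ (Fin d))‖ ^ 2 / lam ^ 2)) +
      (lam : ℂ) ^ d * ((Complex.Gamma (ν / 2))⁻¹ * formFactor L (ψr ν y) +
        kernelReg lam ν (F y))), fun y hy => ?_, fun y hy ν hν => ?_, fun y hy ν hν => ?_,
    fun ν => ?_⟩
  · refine Differentiable.mul (Differentiable.mul
      ((differentiable_id.div_const 2).const_cpow (Or.inl hpi))
      (differentiable_neg.const_cpow (Or.inl hl))) (Differentiable.add ?_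
      (Differentiable.const_mul (Differentiable.add (hginv.mul ?_)
        (differentiable_kernelReg hlam (F y))) _))
    · refine hL.differentiable_tsum (fun z => ?_) (fun ν₀ => ?_) y
      · exact (differentiable_regUpper (by positivity)).comp (differentiable_id.div_const 2)
      · obtain ⟨C, hC⟩ := hL.exists_regUpper_decay hlam (‖ν₀‖ + 1) (d + 1)
        exact ⟨C, fun ν hν z => hC ν (hball ν₀ ν hν) z⟩
    · simp only [fun ν => hL.formFactor_const_sub (ψ ν) y (ψr ν y) (hψr ν y)]
      refine hL.differentiable_tsum (fun z => ?_) (fun ν₀ => ?_) y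
      · have h1 := differentiable_integral_mul_of_decay hψd hψb
          (continuous_phase_right (-z : EuclideanSpace ℝ (Fin d))) (B := 1) (fun x => by simp)
        simp only [← fourier_eq_integral_phase] at h1
        exact h1
      · obtain ⟨C, hC⟩ := hψF (d + 1) (ν₀.re - 1)
        refine ⟨C, fun ν hν z => ?_⟩
        have h2 := Complex.abs_re_le_norm (ν - ν₀)
        rw [mem_ball_iff_norm] at hν
        rw [Complex.sub_re] at h2
        have h3 := hC ν (by linarith [neg_abs_le (ν.re - ν₀.re)])
          (-z : EuclideanSpace ℝ (Fin d))
        rwa [norm_neg] at h3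
  · have hν0 : 0 < ν.re := lt_of_le_of_lt (Nat.cast_nonneg d) hν
    have hG : Complex.Gamma (ν / 2) ≠ 0 := Complex.Gamma_ne_zero_of_re_pos (by
      rw [Complex.div_ofNat_re]
      positivity)
    obtain ⟨hs, hz⟩ := hL.regUpper_add_regLower_tsum hlam hν y
    have h1 := hL.formFactor_add_integral_eq_tsum hlam hf hχd.continuous hχc
      (fun x hx => hVsub (hmem y hy x hx)) hν (hψ ν) (hψr ν y) hs
    simp only [← hF y hy] at h1
    rw [← Gamma_mul_kernelReg hlam hν0] at h1
    rw [← hz]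
    simp only
    congr 2
    have hld : (lam : ℂ) ^ d ≠ 0 := pow_ne_zero _ hl
    field_simp
    rw [h1]
    field_simp
  · have hG : Complex.Gamma (ν / 2) ≠ 0 := Complex.Gamma_ne_zero fun m hm => hν m (by
      linear_combination 2 * hm)
    refine ⟨formFactor L (ψr ν y) + T ν (F y), ⟨χ, f, V, ψ ν, ψr ν y, F y, hχd, hχc, hf,
      fun x hx => hVsub (hmem y hy x hx), fun φ φ' h => ?_, hψr ν y, hF y hy, rfl⟩, ?_⟩
    · rw [hT, hcut h, mul_inv_cancel_left₀ hG]
    · simp only [crandallG_inv_smul_eq hlam hν, hT]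
      have h1 : ∀ z : L, phase y z * (Complex.Gamma (ν / 2) *
          regUpper (ν / 2) (Real.pi * ‖(z : EuclideanSpace ℝ (Fin d))‖ ^ 2 / lam ^ 2)) =
          Complex.Gamma (ν / 2) * (phase y z *
          regUpper (ν / 2) (Real.pi * ‖(z : EuclideanSpace ℝ (Fin d))‖ ^ 2 / lam ^ 2)) :=
        fun z => by ring
      simp only [h1]
      have hlν : (lam : ℂ) ^ ν ≠ 0 := by simp [Complex.cpow_eq_zero_iff, hl]
      rw [tsum_mul_left, Complex.cpow_neg]
      field_simp
  · refine ContDiff.contDiffOn ?_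
    -- Writing `χ g = g - (1 - χ) g` separates a Fourier transform from a convolution of Schwartz
    -- functions, both visibly smooth in `y`.
    have hsplit : ∀ y, kernelReg lam ν (F y) = kernelReg lam ν (fun x => g (y - x)) -
        (Complex.Gamma (ν / 2))⁻¹ * ∫ x, ψ ν x * g (y - x) := by
      intro y
      have h1 := hcut (φ := gr y) (φ' := gr y - F y) (fun x => by
        rw [sub_apply, hF0, hgr]; ring) ν
      rw [kernelReg_sub hlam] at h1
      simp only [hgr] at h1
      rw [← h1, show ((gr y : EuclideanSpace ℝ (Fin d) → ℂ)) = fun x => g (y - x) from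
        funext (hgr y)]
      ring
    simp only [hsplit, fun y => hL.formFactor_const_sub (ψ ν) y (ψr ν y) (hψr ν y)]
    refine contDiff_const.mul (ContDiff.add ?_ (contDiff_const.mul
      ((contDiff_const.mul (hL.contDiff_formFactor_const_sub (ψ ν))).add
        ((contDiff_kernelReg_const_sub hlam ν g).sub
          (contDiff_const.mul ((ψ ν).contDiff_integral_mul_const_sub g))))))
    refine hL.contDiff_tsum_phase fun k => ?_
    obtain ⟨C, hC⟩ := hL.exists_regUpper_decay hlam ‖ν‖ k
    exact ⟨C, hC ν le_rfl⟩

end Main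

theorem theorem3p5 (d : ℕ) (L : Set (EuclideanSpace ℝ (Fin d))) (hL : UniformlyDiscrete L) :
    ∃ Z : ℂ → EuclideanSpace ℝ (Fin d) → ℂ,
      -- `Z` extends the Dirichlet series
      (∀ y ∉ singSupp (formFactor L), ∀ ν : ℂ, (d : ℝ) < ν.re →
        Summable (fun z : ↥(L \ {0}) => setZetaTerm ν y (z : EuclideanSpace ℝ (Fin d))) ∧
        Z ν y = setZeta L ν y) ∧
      -- the extension is meromorphic in `ν`, without poles
      (∀ y ∉ singSupp (formFactor L), Differentiable ℂ (fun ν => Z ν y)) ∧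
      -- the representation
      (∀ lam : ℝ, 0 < lam → ∃ T : ℂ → 𝓢'(EuclideanSpace ℝ (Fin d), ℂ),
        IsKernelDistribution lam T ∧
        ∀ y ∉ singSupp (formFactor L), ∀ ν : ℂ, (∀ n : ℕ, ν ≠ -2 * (n : ℂ)) →
          Summable (fun z : L =>
            Complex.exp (-2 * Real.pi * Complex.I *
              (inner ℝ y (z : EuclideanSpace ℝ (Fin d)) : ℝ)) *
              crandallG ν (lam⁻¹ • (z : EuclideanSpace ℝ (Fin d)))) ∧
          ∃ c : ℂ, HasConvolutionAt (formFactor L) (T ν) y c ∧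
            Z ν y = (Real.pi : ℂ) ^ (ν / 2) / ((lam : ℂ) ^ ν * Complex.Gamma (ν / 2)) *
              ((∑' z : L, Complex.exp (-2 * Real.pi * Complex.I *
                  (inner ℝ y (z : EuclideanSpace ℝ (Fin d)) : ℝ)) *
                  crandallG ν (lam⁻¹ • (z : EuclideanSpace ℝ (Fin d)))) +
                (lam : ℂ) ^ d * c)) ∧
      -- smoothness in `y`
      (∀ ν : ℂ, ContDiffOn ℝ ∞ (Z ν) (singSupp (formFactor L))ᶜ) := by
  have hex : ∀ y : EuclideanSpace ℝ (Fin d), ∃ E : ℂ → ℂ, y ∉ singSupp (formFactor L) →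
      Differentiable ℂ E ∧ ∀ ν : ℂ, (d : ℝ) < ν.re → E ν = setZeta L ν y := by
    intro y
    by_cases hy : y ∈ singSupp (formFactor L)
    · exact ⟨0, fun h => absurd hy h⟩
    · obtain ⟨T, hT⟩ := exists_kernelDistribution d one_pos
      obtain ⟨W, hW, E, hE1, hE2, -⟩ := hL.exists_local_continuation one_pos hT hy
      exact ⟨fun ν => E ν y, fun _ => ⟨hE1 y (mem_of_mem_nhds hW), hE2 y (mem_of_mem_nhds hW)⟩⟩
  choose Z hZ using hex
  -- `Z` is picked pointwise from `λ = 1`. Uniqueness of continuation identifies it with the local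
  -- formula for any `λ` and base point, which transfers both the representation and the smoothness.
  have heq : ∀ {y : EuclideanSpace ℝ (Fin d)}, y ∉ singSupp (formFactor L) → ∀ {E : ℂ → ℂ},
      Differentiable ℂ E → (∀ ν : ℂ, (d : ℝ) < ν.re → E ν = setZeta L ν y) → Z y = E := by
    intro y hy E hd hE
    refine eq_of_eq_on_half_plane (hZ y hy).1 hd d fun ν hν => ?_
    rw [(hZ y hy).2 ν hν, hE ν hν]
  refine ⟨fun ν y => Z y ν, fun y hy ν hν => ⟨hL.summable_setZetaTerm hν y, (hZ y hy).2 ν hν⟩,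
    fun y hy => (hZ y hy).1, fun lam hlam => ?_, fun ν y hy => ?_⟩
  · obtain ⟨T, hT⟩ := exists_kernelDistribution d hlam
    refine ⟨T, isKernelDistribution_of_eq hlam hT, fun y hy ν hν => ⟨?_, ?_⟩⟩
    · refine ((hL.summable_phase_mul_regUpper hlam ν y).mul_left (Complex.Gamma (ν / 2))).congr
        fun z => ?_
      rw [crandallG_inv_smul_eq hlam hν, phase]
      ring
    · obtain ⟨W, hW, E, hE1, hE2, hE3, -⟩ := hL.exists_local_continuation hlam hT hy
      obtain ⟨c, hc, hEc⟩ := hE3 y (mem_of_mem_nhds hW) ν hν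
      refine ⟨c, hc, ?_⟩
      change Z y ν = _
      rw [heq hy (hE1 y (mem_of_mem_nhds hW)) (hE2 y (mem_of_mem_nhds hW))]
      exact hEc
  · obtain ⟨T, hT⟩ := exists_kernelDistribution d one_pos
    obtain ⟨W, hW, E, hE1, hE2, -, hE4⟩ := hL.exists_local_continuation one_pos hT hy
    have h1 : ContDiffWithinAt ℝ ∞ (E ν) (singSupp (formFactor L))ᶜ y :=
      ((hE4 ν).contDiffAt hW).contDiffWithinAt
    refine h1.congr_of_eventuallyEq ?_ ?_
    · filter_upwards [self_mem_nhdsWithin, mem_nhdsWithin_of_mem_nhds hW] with x hx hxW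
      rw [heq hx (hE1 x hxW) (hE2 x hxW)]
    · change Z y ν = E ν y
      rw [heq hy (hE1 y (mem_of_mem_nhds hW)) (hE2 y (mem_of_mem_nhds hW))]
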